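/- Let $n\ge 3$, let $\kappa>0$ and $\gamma\in\mathbb R$ with $\gamma^2>0$, and let $A:\mathbb S^{n-1}\to\mathbb R^{n\times n}$ be real-analytic with $A(\eta)$ symmetric and positive definite for every $\eta$. Let $\mathcal U\subset\mathbb S^{n-1}$ be an open set such that for every $\eta\in\mathcal U$ the matrix $A(\eta)$ has $n$ distinct eigenvalues $0<\varkappa_1(\eta)<\dots<\varkappa_n(\eta)$, and let $r_1,\dots,r_n\in C^\infty(\mathcal U,\mathbb S^{n-1})$ be corresponding normalised eigenvectors (such a choice exists for instance if $\mathcal U$ is simply connected). For $\xi\neq0$ with $\eta=\xi/|\xi|\in\mathcal U$ put $\omega_j(\xi)=|\xi|\sqrt{\varkappa_j(\eta)}$, $a_j(\xi)=r_j(\eta)\cdot\xi$, and let $B(\xi)\in\mathbb C^{(2n+1)\times(2n+1)}$ be the symbol of the thermo-elastic system, which acts on $(v^+,v^-,\vartheta)\in\mathbb C^n\times\mathbb C^n\times\mathbb C$ by $$ v_j^\pm\mapsto \pm\omega_j(\xi)v_j^\pm+\mathrm i\gamma a_j(\xi)\vartheta,\qquad \vartheta\mapsto-\tfrac{\mathrm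 i\gamma}{2}\sum_{j=1}^n a_j(\xi)\,(v_j^++v_j^-)+\mathrm i\kappa|\xi|^2\vartheta . $$ A direction $\eta\in\mathcal U$ is called parabolic if $r_j(\eta)\cdot\eta\ne0$ for all $j=1,\dots,n$. Let $\psi,\tilde\psi\in C^\infty(\mathbb S^{n-1})$ be supported in $\mathcal U$ with $\tilde\psi=1$ on $\operatorname{supp}\psi$, extended to $\mathbb R^n$ as $0$-homogeneous functions, and assume that $\operatorname{supp}\psi$ is contained in the set of parabolic directions. Let $\epsilon>0$ and let $\chi$ be a smooth real function with $\chi(s)=0$ for $s\le\epsilon$ and $\chi(s)=1$ for $s\ge2\epsilon$. Write $\mathrm D=-\mathrm i\nabla$, $\mathrm D_t=-\mathrm i\partial_t$, let $m(\mathrm D)$ be the Fourier multiplier with symbol $m(\xi)$, and let $\|f\|_{p,s}=\|(1+|\mathrm D|^2)^{s/2}f\|_p$. Then there is $C>0$ such that for all $1\le p\le2\le q\le\infty$ the following holds for all $V_0\in\mathcal S(\mathbb R^n;\mathbb C^{2n+1})$, all $t\ge0$, and all solutions $V$, with $V(t,\cdot)\in L^2(\mathbb R^n;\mathbb C^{2n+1})$,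 of $$\mathrm D_tV=B(\mathrm D)V,\qquad V(0,\cdot)=\tilde\psi(\mathrm D)V_0,$$ understood as the ordinary differential equation in $t\ge 0$ for the partial Fourier transform of $V$ at almost every $\xi$, with $\hat V(t,\xi)=0$ for $\xi/|\xi|\notin\operatorname{supp}\tilde\psi$: $$\|\chi(|\mathrm D|)\psi(\mathrm D)V(t,\cdot)\|_q\le K\,\mathrm e^{-Ct}\,\|V_0\|_{p,s}\qquad\text{for every real } s>n\left(\tfrac1p-\tfrac1q\right),$$ $$\|(1-\chi(|\mathrm D|))\psi(\mathrm D)V(t,\cdot)\|_q\le K'\,(1+t)^{-\frac n2\left(\frac1p-\frac1q\right)}\,\|V_0\|_p .$$ The constants $K$ (depending on $p,q,s$) and $K'$ (depending on $p,q$) do not depend on $t$, $V_0$, $V$. -/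

import Mathlib

open MeasureTheory Metric
open scoped ENNReal ContDiff Manifold SchwartzMap FourierTransform

noncomputable section

namespace ThermoElastic

/-- `ℝⁿ` with the Euclidean norm. -/
abbrev Space (n : ℕ) : Type := EuclideanSpace ℝ (Fin n)

/-- The unit sphere `𝕊ⁿ⁻¹`. -/
abbrev Sph (n : ℕ) : Type := sphere (0 : Space n) 1

/-- Index set of the `2n+1` components: the groups `+`, `-`, and the temperature. -/
abbrev Idx (n : ℕ) : Type := (Fin n ⊕ Fin n) ⊕ Unit

/-- `ℂ²ⁿ⁺¹` with the Euclidean norm. -/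
abbrev State (n : ℕ) : Type := EuclideanSpace ℂ (Idx n)

/-- Makes Mathlib's analytic manifold structure on `𝕊ⁿ⁻¹`, modelled on `ℝⁿ⁻¹`, available. -/
instance finrankFact (n : ℕ) [h : Fact (3 ≤ n)] :
    Fact (Module.finrank ℝ (Space n) = (n - 1) + 1) :=
  ⟨by have := h.out; rw [finrank_euclideanSpace_fin]; omega⟩

/-- The elastic operator: a real-analytic function `η ↦ A(η)` on the sphere with values in the
symmetric positive definite real matrices (`Matrix.PosDef` includes symmetry).  Its symbol on
`ℝⁿ` is the 2-homogeneous extension `A(ξ) = |ξ|² A(ξ/|ξ|)`. -/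
structure ElasticSymbol (n : ℕ) [Fact (3 ≤ n)] where
  toFun : Sph n → Matrix (Fin n) (Fin n) ℝ
  analytic : ∀ i j, ContMDiff (𝓡 (n - 1)) 𝓘(ℝ, ℝ) ω (fun η => toFun η i j)
  posDef : ∀ η, (toFun η).PosDef

/-- `L²(ℝⁿ; ℂ²ⁿ⁺¹)`. -/
abbrev L2 (n : ℕ) : Type := Lp (State n) 2 (volume : Measure (Space n))

section Directions

variable {n : ℕ} [Fact (3 ≤ n)] (A : ElasticSymbol n)

/-- `η` is (elastically) non-degenerate: `A(η)` has `n` distinct eigenvalues. -/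
def IsNondegenerate (η : Sph n) : Prop :=
  (spectrum ℝ (A.toFun η)).ncard = n

/-- The eigenvalues `ϰ₁(η) ≤ ⋯ ≤ ϰₙ(η)` of `A(η)` in ascending order
(`eigenvalues₀` lists them in descending order). -/
def eigenvalue (j : Fin n) (η : Sph n) : ℝ :=
  (A.posDef η).isHermitian.eigenvalues₀ (Fin.cast (Fintype.card_fin n).symm j.rev)

/-- `r₁, …, rₙ` is a smooth choice on `𝓤` of normalised eigenvectors of `A(η)` associated
to `ϰ₁(η), …, ϰₙ(η)`. -/
structure IsEigenframe (U : Set (Sph n)) (r : Fin n → Sph n → Space n) : Prop where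
  smooth : ∀ j, ContMDiffOn (𝓡 (n - 1)) 𝓘(ℝ, Space n) ∞ (r j) U
  norm_eq_one : ∀ j, ∀ η ∈ U, ‖r j η‖ = 1
  eigen : ∀ j, ∀ η ∈ U,
    Matrix.toEuclideanLin (A.toFun η) (r j η) = eigenvalue A j η • r j η

/-- `η` is parabolic: it is non-degenerate and no coupling function `aⱼ(η) = rⱼ(η) · η`
vanishes. -/
def IsParabolic (r : Fin n → Sph n → Space n) (η : Sph n) : Prop :=
  IsNondegenerate A η ∧ ∀ j, inner ℝ (r j η) (η : Space n) ≠ 0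

end Directions

section Symbols

variable {n : ℕ}

/-- The direction `η = ξ/|ξ|` of a nonzero frequency. -/
def direction (ξ : Space n) (h : ξ ≠ 0) : Sph n :=
  ⟨‖ξ‖⁻¹ • ξ, by
    rw [mem_sphere_zero_iff_norm, norm_smul, norm_inv, norm_norm,
      inv_mul_cancel₀ (norm_ne_zero_iff.mpr h)]⟩

/-- The open cone `{ξ ≠ 0 | ξ/|ξ| ∈ S}` over a set of directions. -/
def cone (S : Set (Sph n)) : Set (Space n) :=
  {ξ | ∃ h : ξ ≠ 0, direction ξ h ∈ S}

open Classical in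
/-- The 0-homogeneous extension to `ℝⁿ` of a function on the sphere (with the irrelevant value
`0` at the origin). -/
def homExt (ψ : Sph n → ℂ) (ξ : Space n) : ℂ :=
  if h : ξ ≠ 0 then ψ (direction ξ h) else 0

variable [Fact (3 ≤ n)]

/-- `ωⱼ(ξ) = √ϰⱼ(ξ) = |ξ| √ϰⱼ(η)` for `ξ = |ξ| η`. -/
def omega (A : ElasticSymbol n) (j : Fin n) (ξ : Space n) (h : ξ ≠ 0) : ℝ :=
  ‖ξ‖ * √(eigenvalue A j (direction ξ h))

/-- The coupling function `aⱼ(ξ) = rⱼ(η) · ξ`. -/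
def coupling (r : Fin n → Sph n → Space n) (j : Fin n) (ξ : Space n) (h : ξ ≠ 0) : ℝ :=
  inner ℝ (r j (direction ξ h)) ξ

/-- The coefficient matrix `B(ξ)` of the first order system `D_t V̂ = B(ξ) V̂`, `D_t = -i ∂_t`,
for `ξ ≠ 0`:
`V⁺ⱼ ↦ ωⱼ V⁺ⱼ + iγ aⱼ θ`, `V⁻ⱼ ↦ -ωⱼ V⁻ⱼ + iγ aⱼ θ`,
`θ ↦ -(iγ/2) ∑ⱼ aⱼ (V⁺ⱼ + V⁻ⱼ) + iκ|ξ|² θ`. -/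
def symbolB (A : ElasticSymbol n) (κ γ : ℝ) (r : Fin n → Sph n → Space n)
    (ξ : Space n) (h : ξ ≠ 0) : Matrix (Idx n) (Idx n) ℂ :=
  Matrix.fromBlocks
    (Matrix.fromBlocks
      (Matrix.diagonal fun j => (omega A j ξ h : ℂ)) 0
      0 (Matrix.diagonal fun j => -(omega A j ξ h : ℂ)))
    (Matrix.of fun i _ => Complex.I * γ * coupling r (Sum.elim id id i) ξ h)
    (Matrix.of fun _ i => -(Complex.I * γ / 2) * coupling r (Sum.elim id id i) ξ h)
    (Matrix.of fun _ _ => Complex.I * κ * (‖ξ‖ ^ 2 : ℝ))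

end Symbols

section Multipliers

variable {n : ℕ}

open Classical in
/-- The Fourier multiplier `m(D)`, `D = -i∂`, on `L²(ℝⁿ; ℂ²ⁿ⁺¹)`.  Mathlib's Fourier transform
has kernel `exp(-2πi x·k)`, so the frequency is `ξ = 2πk`.  (For `m` not mapping `f` into `L²` the
value is `0`; this does not occur for bounded measurable `m`, see `fourier_multiplier`.) -/
def multiplier (m : Space n → ℂ) (f : L2 n) : L2 n :=
  if h : MemLp (fun k => m ((2 * Real.pi) • k) • (𝓕 f : L2 n) k) 2
      (volume : Measure (Space n)) then 𝓕⁻ (h.toLp _ : L2 n) else 0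

theorem fourier_multiplier {m : Space n → ℂ} (hm : Measurable m) {C : ℝ} (hC : ∀ ξ, ‖m ξ‖ ≤ C)
    (f : L2 n) :
    (𝓕 (multiplier m f) : L2 n) =ᵐ[volume] fun k => m ((2 * Real.pi) • k) • (𝓕 f : L2 n) k := by
  have h : MemLp (fun k => m ((2 * Real.pi) • k) • (𝓕 f : L2 n) k) 2
      (volume : Measure (Space n)) := by
    refine MemLp.of_le_mul (c := C) (Lp.memLp (𝓕 f : L2 n)) ?_ ?_
    · exact (hm.comp (measurable_const_smul _)).aestronglyMeasurable.smul
        (Lp.aestronglyMeasurable _)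
    · filter_upwards with k
      rw [norm_smul]
      exact mul_le_mul_of_nonneg_right (hC _) (norm_nonneg _)
  rw [multiplier, dif_pos h, FourierTransform.fourier_fourierInv_eq]
  exact h.coeFn_toLp

/-- The Sobolev (Bessel potential) norm `‖f‖_{p,r} = ‖(1 + |D|²)^{r/2} f‖_p`. -/
def sobolevNorm (p : ℝ≥0∞) (r : ℝ) (f : 𝓢(Space n, State n)) : ℝ≥0∞ :=
  eLpNorm (SchwartzMap.fourierMultiplierCLM (State n)
    (fun k : Space n => (((1 + ‖(2 * Real.pi) • k‖ ^ 2) ^ (r / 2) : ℝ) : ℂ)) f) p volume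

variable [Fact (3 ≤ n)]

/-- `V(t)`, `t ≥ 0`, solves `D_t V = B(D) V`, `V(0) = ψ'(D) V₀`.  The equation is the ordinary
differential equation `∂_t W(t,ξ) = i B(ξ) W(t,ξ)` for the partial Fourier transform `W` of `V`;
`B(ξ)` is only used on the cone over `supp ψ'`, outside of which `W` vanishes. -/
def IsSolution (A : ElasticSymbol n) (κ γ : ℝ) (r : Fin n → Sph n → Space n)
    (ψ' : Sph n → ℂ) (V₀ : 𝓢(Space n, State n))
    (V : ℝ → L2 n) : Prop :=
  V 0 = multiplier (homExt ψ') (V₀.toLp 2) ∧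
  ∃ W : ℝ → Space n → State n,
    (∀ t, 0 ≤ t → ∀ᵐ ξ, W t ξ = (𝓕 (V t) : L2 n) ((2 * Real.pi)⁻¹ • ξ)) ∧
    (∀ᵐ ξ, ξ ∉ cone (tsupport ψ') → ∀ t, 0 ≤ t → W t ξ = 0) ∧
    (∀ᵐ ξ, ∀ h : ξ ≠ 0, direction ξ h ∈ tsupport ψ' → ∀ t, 0 ≤ t →
      HasDerivWithinAt (fun s => W s ξ)
        (Complex.I • Matrix.toEuclideanLin (symbolB A κ γ r ξ h) (W t ξ)) (Set.Ici 0) t)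

end Multipliers

end ThermoElastic

end

/-!
Fourier transformation turns the system into an ordinary differential equation for every frequency
`ξ`.  After scaling the temperature by `√2` it reads `w' = (|ξ| S - κ|ξ|² P) w`, where `S` is
skew-Hermitian and depends only on the direction of `ξ`, and `P` is the projection onto the
temperature.  The energy `‖w‖²` alone only controls the temperature.  In a parabolic direction no
eigenvector of `S` lies in the kernel of `P`: since the eigenvalues `±√ϰⱼ` of the elastic part are
distinct, such an eigenvector would be a single mode, and every mode is coupled to the temperature.
Hence the Lyapunov equation `X - (S* X + X S) = P` has a positive definite solution `X`, which is a
compensator: adding a small multiple of `⟪w, X w⟫` to the energy makes its derivative negative on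
all components.  As compensators persist under small perturbations, compactness gives
`|V̂(t,ξ)| ≤ 3 exp(-c min(1,|ξ|²) t) |V̂₀(ξ)|` uniformly over the support of `ψ`.

The Hausdorff–Young inequality, here up to a constant by Marcinkiewicz interpolation, and Hölder's
inequality then bound the `L^q` norm by the `L^ρ` norm of a Fourier weight, `1/ρ = 1/p - 1/q`, times
the `L^p` norm of the data.  For high frequencies the weight is `exp(-c t)` times a Bessel
potential, for low frequencies it is a Gaussian of width `(1+t)^(-1/2)`.
-/

noncomputable section

section Interpolation

variable {α β F G : Type*} {mα : MeasurableSpace α} {mβ : MeasurableSpace β} {μ : Measure α}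
  {ν : Measure β} [NormedAddCommGroup F] [NormedAddCommGroup G]

theorem eLpNorm_one_indicator_lt_rpow_le {f : α → F} {p c : ℝ} (hp : 0 < p)
    (hf : Integrable (fun x => ‖f x‖ ^ p) μ) (hc : 0 < c) :
    eLpNorm ({x | c < ‖f x‖ ^ (p - 1)}.indicator f) 1 μ ≤
      ENNReal.ofReal (c⁻¹ * ∫ x, ‖f x‖ ^ p ∂μ) := by
  rw [eLpNorm_one_eq_lintegral_enorm, ← integral_const_mul,
    ofReal_integral_eq_lintegral_ofReal (hf.const_mul _) (ae_of_all _ fun x => by positivity)]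
  refine lintegral_mono fun x => ?_
  by_cases hx : c < ‖f x‖ ^ (p - 1)
  · rw [Set.indicator_of_mem (by exact hx), ← ofReal_norm]
    refine ENNReal.ofReal_le_ofReal ?_
    calc ‖f x‖ = c⁻¹ * (c * ‖f x‖) := by field_simp
      _ ≤ c⁻¹ * (‖f x‖ ^ (p - 1) * ‖f x‖) := by gcongr
      _ = c⁻¹ * ‖f x‖ ^ p := by
        rw [← Real.rpow_add_one' (norm_nonneg _) (by simpa using hp.ne'), sub_add_cancel]
  · rw [Set.indicator_of_notMem (by exact hx)]
    simp

theorem measure_lt_norm_add_le {u v : β → G} {t : ℝ} (ht : 0 < t)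
    (hu : eLpNorm u ⊤ ν ≤ ENNReal.ofReal (t / 2)) (hv : AEStronglyMeasurable v ν) :
    ν {y | t < ‖u y + v y‖} ≤ ENNReal.ofReal (4 / t ^ 2) * eLpNorm v 2 ν ^ 2 := by
  have hsub : ν {y | t < ‖u y + v y‖} ≤ ν {y | ENNReal.ofReal (t / 2) ≤ ‖v y‖ₑ} := by
    refine measure_mono_ae ?_
    rw [eLpNorm_exponent_top] at hu
    filter_upwards [enorm_ae_le_eLpNormEssSup u ν] with y hy (hty : t < ‖u y + v y‖)
    have huy : ‖u y‖ ≤ t / 2 := by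
      rw [← ENNReal.ofReal_le_ofReal_iff (by positivity), ofReal_norm]
      exact hy.trans hu
    change ENNReal.ofReal (t / 2) ≤ ‖v y‖ₑ
    rw [← ofReal_norm]
    exact ENNReal.ofReal_le_ofReal (by linarith [norm_add_le (u y) (v y)])
  have hcoef : (ENNReal.ofReal (t / 2))⁻¹ ^ (2 : ℝ≥0∞).toReal = ENNReal.ofReal (4 / t ^ 2) := by
    rw [← ENNReal.ofReal_inv_of_pos (by positivity), ENNReal.toReal_ofNat, ENNReal.rpow_ofNat,
      ← ENNReal.ofReal_pow (by positivity)]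
    congr 1
    ring
  calc ν {y | t < ‖u y + v y‖}
      ≤ ν {y | ENNReal.ofReal (t / 2) ≤ ‖v y‖ₑ} := hsub
    _ ≤ (ENNReal.ofReal (t / 2))⁻¹ ^ (2 : ℝ≥0∞).toReal * eLpNorm v 2 ν ^ (2 : ℝ≥0∞).toReal :=
      meas_ge_le_mul_pow_eLpNorm_enorm ν two_ne_zero ENNReal.ofNat_ne_top hv
        (by simpa using ht) (by simp)
    _ = ENNReal.ofReal (4 / t ^ 2) * eLpNorm v 2 ν ^ 2 := by
      rw [hcoef, ENNReal.toReal_ofNat, ENNReal.rpow_ofNat]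

theorem eLpNorm_two_indicator_sq (f : α → F) (S : Set α) [DecidablePred (· ∈ S)] :
    eLpNorm (S.indicator f) 2 μ ^ 2 = ∫⁻ x, (if x ∈ S then ‖f x‖ₑ ^ 2 else 0) ∂μ := by
  have hsq := eLpNorm_nnreal_pow_eq_lintegral (μ := μ) (f := S.indicator f) (p := 2) two_ne_zero
  simp only [NNReal.coe_ofNat, ENNReal.rpow_ofNat, ENNReal.coe_ofNat] at hsq
  rw [hsq]
  refine lintegral_congr fun x => ?_
  by_cases hx : x ∈ S <;> simp [hx]

/-- Split `f` where `‖f‖ ^ (p - 1)` crosses `c`: the large part is sent into the ball of radius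
`t / 2` of `L^∞`, so Chebyshev's inequality only sees the small part. -/
theorem measure_lt_norm_le_of_truncation {T : Lp F 2 μ → Lp G 2 ν}
    (hadd : ∀ f g, T (f + g) = T f + T g) (hT₂ : ∀ f, ‖T f‖ ≤ ‖f‖)
    (hT₁ : ∀ f, eLpNorm (T f) ⊤ ν ≤ eLpNorm f 1 μ) {p c t : ℝ} (hp : 0 < p) (hc : 0 < c)
    (ht : 0 < t) (f : Lp F 2 μ) (hf : Integrable (fun x => ‖f x‖ ^ p) μ)
    (hct : c⁻¹ * ∫ x, ‖f x‖ ^ p ∂μ ≤ t / 2) :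
    ν {y | t < ‖T f y‖} ≤ ENNReal.ofReal (4 / t ^ 2) *
      ∫⁻ x, (if ‖f x‖ ^ (p - 1) ≤ c then ‖f x‖ₑ ^ 2 else 0) ∂μ := by
  have hS : MeasurableSet {x | c < ‖f x‖ ^ (p - 1)} :=
    measurableSet_lt measurable_const ((Lp.stronglyMeasurable f).norm.measurable.pow_const _)
  have hScompl : {x | c < ‖f x‖ ^ (p - 1)}ᶜ = {x | ‖f x‖ ^ (p - 1) ≤ c} := by
    ext x; simp
  have hlarge : MemLp ({x | c < ‖f x‖ ^ (p - 1)}.indicator f) 2 μ := (Lp.memLp f).indicator hS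
  have hsmall : MemLp ({x | ‖f x‖ ^ (p - 1) ≤ c}.indicator f) 2 μ :=
    (Lp.memLp f).indicator (hScompl ▸ hS.compl)
  have hsplit : f = hlarge.toLp + hsmall.toLp := by
    apply Lp.ext
    filter_upwards [Lp.coeFn_add hlarge.toLp hsmall.toLp, hlarge.coeFn_toLp,
      hsmall.coeFn_toLp] with x hadd_x hlarge_x hsmall_x
    rw [hadd_x, Pi.add_apply, hlarge_x, hsmall_x, ← hScompl, ← Pi.add_apply,
      Set.indicator_self_add_compl]
  have hsup : eLpNorm (T hlarge.toLp) ⊤ ν ≤ ENNReal.ofReal (t / 2) :=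
    calc eLpNorm (T hlarge.toLp) ⊤ ν ≤ eLpNorm hlarge.toLp 1 μ := hT₁ _
      _ = eLpNorm ({x | c < ‖f x‖ ^ (p - 1)}.indicator f) 1 μ :=
        eLpNorm_congr_ae hlarge.coeFn_toLp
      _ ≤ ENNReal.ofReal (c⁻¹ * ∫ x, ‖f x‖ ^ p ∂μ) := eLpNorm_one_indicator_lt_rpow_le hp hf hc
      _ ≤ ENNReal.ofReal (t / 2) := ENNReal.ofReal_le_ofReal hct
  have henergy : eLpNorm (T hsmall.toLp) 2 ν ^ 2 ≤
      ∫⁻ x, (if ‖f x‖ ^ (p - 1) ≤ c then ‖f x‖ₑ ^ 2 else 0) ∂μ :=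
    calc eLpNorm (T hsmall.toLp) 2 ν ^ 2 ≤ eLpNorm hsmall.toLp 2 μ ^ 2 := by
          gcongr
          rw [← Lp.enorm_def, ← Lp.enorm_def, ← ofReal_norm, ← ofReal_norm]
          exact ENNReal.ofReal_le_ofReal (hT₂ _)
      _ = ∫⁻ x, (if ‖f x‖ ^ (p - 1) ≤ c then ‖f x‖ₑ ^ 2 else 0) ∂μ := by
          rw [eLpNorm_congr_ae hsmall.coeFn_toLp]
          exact eLpNorm_two_indicator_sq _ _
  have hTf : T f =ᵐ[ν] fun y => T hlarge.toLp y + T hsmall.toLp y := by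
    conv_lhs => rw [hsplit, hadd]
    exact Lp.coeFn_add _ _
  calc ν {y | t < ‖T f y‖} = ν {y | t < ‖T hlarge.toLp y + T hsmall.toLp y‖} :=
        measure_congr (by filter_upwards [hTf] with y hy; exact congrArg (t < ‖·‖) hy)
    _ ≤ _ := measure_lt_norm_add_le ht hsup (Lp.aestronglyMeasurable _)
    _ ≤ _ := by gcongr

theorem lintegral_Ioc_ofReal_rpow {r M : ℝ} (hr : -1 < r) (hM : 0 ≤ M) :
    ∫⁻ t in Set.Ioc 0 M, ENNReal.ofReal (t ^ r) = ENNReal.ofReal (M ^ (r + 1) / (r + 1)) := by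
  have hint : IntegrableOn (fun t : ℝ => t ^ r) (Set.Ioc 0 M) :=
    (intervalIntegrable_iff_integrableOn_Ioc_of_le hM).1
      (intervalIntegral.intervalIntegrable_rpow' hr)
  rw [← ofReal_integral_eq_lintegral_ofReal hint
    ((ae_restrict_iff' measurableSet_Ioc).2 (ae_of_all _ fun t ht => Real.rpow_nonneg ht.1.le r)),
    ← intervalIntegral.integral_of_le hM, integral_rpow (Or.inl hr),
    Real.zero_rpow (by linarith), sub_zero]

theorem lintegral_truncated_layer {p q A : ℝ} (hp : 1 < p) (hq : 2 < q) (hA : 0 < A)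
    (hpq : (p - 1) * (q - 2) = 2 - p) (v : F) :
    ∫⁻ t in Set.Ioi (0 : ℝ), ENNReal.ofReal (4 / t ^ 2) *
        (if ‖v‖ ^ (p - 1) ≤ 2 * A / t then ‖v‖ₑ ^ 2 else 0) * ENNReal.ofReal (t ^ (q - 1)) =
      ENNReal.ofReal (4 / (q - 2) * (2 * A) ^ (q - 2) * ‖v‖ ^ p) := by
  rcases (norm_nonneg v).eq_or_lt with hv | hv
  · simp [norm_eq_zero.1 hv.symm, (zero_lt_one.trans hp).ne']
  set M : ℝ := 2 * A / ‖v‖ ^ (p - 1) with hM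
  have hM₀ : 0 < M := by positivity
  have hIoc : ∀ t ∈ Set.Ioi (0 : ℝ), ENNReal.ofReal (4 / t ^ 2) *
        (if ‖v‖ ^ (p - 1) ≤ 2 * A / t then ‖v‖ₑ ^ 2 else 0) * ENNReal.ofReal (t ^ (q - 1)) =
      (Set.Ioc 0 M).indicator
        (fun t => ENNReal.ofReal (4 * ‖v‖ ^ 2) * ENNReal.ofReal (t ^ (q - 3))) t := by
    intro t (ht : 0 < t)
    have htM : ‖v‖ ^ (p - 1) ≤ 2 * A / t ↔ t ∈ Set.Ioc 0 M := by
      rw [Set.mem_Ioc, hM, le_div_iff₀ ht, le_div_iff₀ (by positivity), mul_comm]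
      exact (and_iff_right ht).symm
    have hpow : t ^ (q - 1) = t ^ (q - 3) * t ^ 2 := by
      rw [← Real.rpow_natCast, ← Real.rpow_add ht, Nat.cast_ofNat]
      ring_nf
    simp only [htM, Set.indicator_apply]
    split_ifs
    · rw [← ofReal_norm, ← ENNReal.ofReal_pow hv.le, ← ENNReal.ofReal_mul (by positivity),
        ← ENNReal.ofReal_mul (by positivity), ← ENNReal.ofReal_mul (by positivity), hpow]
      congr 1
      field_simp
    · simp
  have hMpow : ‖v‖ ^ 2 * M ^ (q - 2) = (2 * A) ^ (q - 2) * ‖v‖ ^ p := by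
    rw [hM, Real.div_rpow (by positivity) (by positivity), ← Real.rpow_mul hv.le, hpq,
      ← Real.rpow_natCast, Nat.cast_ofNat, ← sub_sub_cancel 2 p, Real.rpow_sub hv 2 (2 - p),
      sub_sub_cancel]
    ring
  rw [setLIntegral_congr_fun measurableSet_Ioi hIoc, setLIntegral_indicator measurableSet_Ioc,
    Set.inter_eq_left.2 Set.Ioc_subset_Ioi_self, lintegral_const_mul' _ _ ENNReal.ofReal_ne_top,
    lintegral_Ioc_ofReal_rpow (by linarith) hM₀.le, ← ENNReal.ofReal_mul (by positivity)]
  congr 1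
  rw [show q - 3 + 1 = q - 2 by ring, mul_assoc (4 / (q - 2)), ← hMpow]
  ring

theorem measurable_uncurry_truncated_layer {f : α → F} (hf : StronglyMeasurable f) (p q A : ℝ) :
    Measurable (Function.uncurry fun (t : ℝ) (x : α) => ENNReal.ofReal (4 / t ^ 2) *
      (if ‖f x‖ ^ (p - 1) ≤ 2 * A / t then ‖f x‖ₑ ^ 2 else 0) * ENNReal.ofReal (t ^ (q - 1))) := by
  have hnorm : Measurable fun z : ℝ × α => ‖f z.2‖ := hf.norm.measurable.comp measurable_snd
  have henorm : Measurable fun z : ℝ × α => ‖f z.2‖ₑ := hf.enorm.comp measurable_snd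
  have hset : MeasurableSet {z : ℝ × α | ‖f z.2‖ ^ (p - 1) ≤ 2 * A / z.1} :=
    measurableSet_le (hnorm.pow_const _) (by fun_prop)
  have hite : Measurable fun z : ℝ × α =>
      if ‖f z.2‖ ^ (p - 1) ≤ 2 * A / z.1 then ‖f z.2‖ₑ ^ 2 else 0 :=
    Measurable.ite hset (henorm.pow_const 2) measurable_const
  unfold Function.uncurry
  fun_prop

/-- The layer cake formula for `T f`, with each level `t` estimated by the truncation of `f` that
is optimal at that level; Tonelli's theorem then evaluates the resulting double integral. -/
theorem lintegral_ofReal_norm_rpow_le_of_sup [SFinite μ] {T : Lp F 2 μ → Lp G 2 ν}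
    (hadd : ∀ f g, T (f + g) = T f + T g) (hT₂ : ∀ f, ‖T f‖ ≤ ‖f‖)
    (hT₁ : ∀ f, eLpNorm (T f) ⊤ ν ≤ eLpNorm f 1 μ) {p q A : ℝ} (hp : 1 < p) (hq : 2 < q)
    (hpq : (p - 1) * (q - 2) = 2 - p) (f : Lp F 2 μ) (hf : Integrable (fun x => ‖f x‖ ^ p) μ)
    (hA : ∫ x, ‖f x‖ ^ p ∂μ = A) (hA₀ : 0 < A) :
    ∫⁻ y, ENNReal.ofReal (‖T f y‖ ^ q) ∂ν ≤
      ENNReal.ofReal (4 * q / (q - 2) * 2 ^ (q - 2) * A ^ (q - 1)) := by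
  have hlevel : ∀ t ∈ Set.Ioi (0 : ℝ), ν {y | t < ‖T f y‖} * ENNReal.ofReal (t ^ (q - 1)) ≤
      ∫⁻ x, ENNReal.ofReal (4 / t ^ 2) * (if ‖f x‖ ^ (p - 1) ≤ 2 * A / t then ‖f x‖ₑ ^ 2 else 0) *
        ENNReal.ofReal (t ^ (q - 1)) ∂μ := by
    intro t (ht : 0 < t)
    rw [lintegral_mul_const' _ _ ENNReal.ofReal_ne_top,
      lintegral_const_mul' _ _ ENNReal.ofReal_ne_top]
    gcongr
    refine measure_lt_norm_le_of_truncation hadd hT₂ hT₁ (by linarith) (by positivity) ht f hf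
      (le_of_eq ?_)
    rw [hA]
    field_simp
  have hq₂ : 0 < q - 2 := sub_pos.2 hq
  calc ∫⁻ y, ENNReal.ofReal (‖T f y‖ ^ q) ∂ν
      = ENNReal.ofReal q *
          ∫⁻ t in Set.Ioi 0, ν {y | t < ‖T f y‖} * ENNReal.ofReal (t ^ (q - 1)) :=
        lintegral_rpow_eq_lintegral_meas_lt_mul ν (ae_of_all _ fun _ => norm_nonneg _)
          (Lp.aestronglyMeasurable (T f)).norm.aemeasurable (by linarith)
    _ ≤ ENNReal.ofReal q * ∫⁻ t in Set.Ioi (0 : ℝ), ∫⁻ x, ENNReal.ofReal (4 / t ^ 2) *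
          (if ‖f x‖ ^ (p - 1) ≤ 2 * A / t then ‖f x‖ₑ ^ 2 else 0) *
            ENNReal.ofReal (t ^ (q - 1)) ∂μ := by
        gcongr 1
        exact setLIntegral_mono' measurableSet_Ioi hlevel
    _ = ENNReal.ofReal q *
          ∫⁻ x, ENNReal.ofReal (4 / (q - 2) * (2 * A) ^ (q - 2) * ‖f x‖ ^ p) ∂μ := by
        rw [lintegral_lintegral_swap
          (measurable_uncurry_truncated_layer (Lp.stronglyMeasurable f) p q A).aemeasurable]
        simp only [lintegral_truncated_layer hp hq hA₀ hpq]
    _ = ENNReal.ofReal (4 * q / (q - 2) * 2 ^ (q - 2) * A ^ (q - 1)) := by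
        rw [← ofReal_integral_eq_lintegral_ofReal (hf.const_mul _)
          (ae_of_all _ fun x => by positivity), integral_const_mul, hA,
          ← ENNReal.ofReal_mul (by linarith), Real.mul_rpow two_pos.le hA₀.le,
          show q - 1 = q - 2 + 1 by ring, Real.rpow_add_one hA₀.ne']
        congr 1
        ring

theorem eLpNorm_map_eq_zero {T : Lp F 2 μ → Lp G 2 ν} (hT : ∀ f, ‖T f‖ ≤ ‖f‖) {p q : ℝ≥0∞}
    (hp : p ≠ 0) {f : Lp F 2 μ} (hf : eLpNorm f p μ = 0) : eLpNorm (T f) q ν = 0 := by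
  have hf₀ : f = 0 := Lp.ext
    (((eLpNorm_eq_zero_iff (Lp.aestronglyMeasurable f) hp).1 hf).trans (Lp.coeFn_zero ..).symm)
  have hTf : T f = 0 := norm_le_zero_iff.1 ((hT f).trans_eq (by rw [hf₀, norm_zero]))
  rw [hTf, eLpNorm_congr_ae (Lp.coeFn_zero ..), eLpNorm_zero]

theorem exists_eLpNorm_le_of_sup [SFinite μ] {T : Lp F 2 μ → Lp G 2 ν}
    (hadd : ∀ f g, T (f + g) = T f + T g) (hT₂ : ∀ f, ‖T f‖ ≤ ‖f‖)
    (hT₁ : ∀ f, eLpNorm (T f) ⊤ ν ≤ eLpNorm f 1 μ) {p q : ℝ} (hp : 1 < p) (hp₂ : p < 2)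
    (hpq : p.HolderConjugate q) :
    ∃ C : ℝ, 0 < C ∧ ∀ f, eLpNorm (T f) (ENNReal.ofReal q) ν ≤
      ENNReal.ofReal C * eLpNorm f (ENNReal.ofReal p) μ := by
  have hmul : p * q = p + q := hpq.mul_eq_add
  have hq : 2 < q := by nlinarith
  have hp₀ : 0 < p := hpq.pos
  have hq₀ : 0 < q := hpq.symm.pos
  have hq₂ : 0 < q - 2 := sub_pos.2 hq
  set B : ℝ := 4 * q / (q - 2) * 2 ^ (q - 2)
  refine ⟨B ^ q⁻¹, by positivity, fun f => ?_⟩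
  by_cases hf : eLpNorm f (ENNReal.ofReal p) μ = ⊤
  · rw [hf, ENNReal.mul_top (ENNReal.ofReal_pos.2 (by positivity)).ne']
    exact le_top
  have hmem : MemLp f (ENNReal.ofReal p) μ :=
    ⟨Lp.aestronglyMeasurable f, lt_top_iff_ne_top.2 hf⟩
  have hint : Integrable (fun x => ‖f x‖ ^ p) μ := by
    simpa [hp₀.le] using hmem.integrable_norm_rpow (by simpa using hp₀) ENNReal.ofReal_ne_top
  obtain ⟨A, hA⟩ : ∃ A, ∫ x, ‖f x‖ ^ p ∂μ = A := ⟨_, rfl⟩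
  have hnorm : eLpNorm f (ENNReal.ofReal p) μ = ENNReal.ofReal (A ^ p⁻¹) := by
    rw [hmem.eLpNorm_eq_integral_rpow_norm (by simpa using hp₀) ENNReal.ofReal_ne_top,
      ENNReal.toReal_ofReal hp₀.le, hA]
  rcases (hA ▸ integral_nonneg fun x => by positivity : 0 ≤ A).eq_or_lt with rfl | hA₀
  · rw [eLpNorm_map_eq_zero hT₂ (ENNReal.ofReal_pos.2 hp₀).ne' (by simp [hnorm, hp₀.ne'])]
    exact zero_le
  have hpow : (B * A ^ (q - 1)) ^ q⁻¹ = B ^ q⁻¹ * A ^ p⁻¹ := by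
    rw [Real.mul_rpow (by positivity) (by positivity), ← Real.rpow_mul hA₀.le]
    congr 2
    field_simp
    linarith
  rw [hnorm, ← ENNReal.ofReal_mul (by positivity), ← hpow,
    ← ENNReal.ofReal_rpow_of_pos (by positivity),
    eLpNorm_eq_lintegral_rpow_enorm_toReal (by simpa using hq₀) ENNReal.ofReal_ne_top,
    ENNReal.toReal_ofReal hq₀.le, one_div]
  gcongr
  simpa only [← ofReal_norm, ENNReal.ofReal_rpow_of_nonneg (norm_nonneg _) hq₀.le] using
    lintegral_ofReal_norm_rpow_le_of_sup hadd hT₂ hT₁ hp hq (by linarith) f hint hA hA₀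

end Interpolation

section HausdorffYoung

variable {E F : Type*} [NormedAddCommGroup E] [InnerProductSpace ℝ E] [FiniteDimensional ℝ E]
  [MeasurableSpace E] [BorelSpace E] [NormedAddCommGroup F] [InnerProductSpace ℂ F]
  [CompleteSpace F]

local notation "L²" => Lp F 2 (volume : Measure E)

theorem coeFn_fourier_ae_eq (f : L²) (hf : Integrable f volume) :
    (𝓕 f : L²) =ᵐ[volume] 𝓕 (f : E → F) := by
  have hcont : Continuous (𝓕 (f : E → F)) :=
    VectorFourier.fourierIntegral_continuous Real.continuous_fourierChar
      (by exact continuous_inner) hf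
  refine ae_eq_of_integral_contDiff_smul_eq
    ((Lp.memLp (𝓕 f : L²)).locallyIntegrable one_le_two) hcont.locallyIntegrable
    fun g g_smooth g_supp => ?_
  let φ : 𝓢(E, ℂ) := HasCompactSupport.toSchwartzMap (f := Complex.ofRealCLM ∘ g)
    (g_supp.comp_left rfl) (by fun_prop)
  have hdual := congrArg (fun T => T φ) (Lp.fourier_toTemperedDistribution_eq f)
  simp only [TemperedDistribution.fourier_apply, Lp.toTemperedDistribution_apply] at hdual
  have hflip : ∫ x, (𝓕 (φ : E → ℂ)) x • f x = ∫ x, φ x • (𝓕 (f : E → F)) x := by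
    simpa using! VectorFourier.integral_fourierIntegral_smul_eq_flip (L := innerₗ E)
      Real.continuous_fourierChar continuous_inner φ.integrable hf
  rw [SchwartzMap.fourier_coe, hflip] at hdual
  simpa [φ] using hdual.symm

theorem eLpNorm_fourier_top_le (f : L²) :
    eLpNorm (𝓕 f : L²) ⊤ volume ≤ eLpNorm f 1 volume := by
  by_cases hf : Integrable f volume
  · rw [eLpNorm_congr_ae (coeFn_fourier_ae_eq f hf), eLpNorm_exponent_top]
    refine eLpNormEssSup_le_of_ae_enorm_bound (ae_of_all _ fun x => ?_)
    rw [eLpNorm_one_eq_lintegral_enorm, ← ofReal_integral_norm_eq_lintegral_enorm hf, ← ofReal_norm]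
    exact ENNReal.ofReal_le_ofReal
      (VectorFourier.norm_fourierIntegral_le_integral_norm Real.fourierChar volume (innerₗ E) f x)
  · have hf_top : eLpNorm f 1 volume = ⊤ := by
      by_contra h
      exact hf (memLp_one_iff_integrable.1 ⟨Lp.aestronglyMeasurable f, lt_top_iff_ne_top.2 h⟩)
    simp [hf_top]

theorem fourierInv_eq_compMeasurePreserving_neg_fourier (f : L²) :
    𝓕⁻ f = Lp.compMeasurePreserving (fun x : E => -x) (Measure.measurePreserving_neg volume)
      (𝓕 f : L²) := by
  refine DenseRange.induction_on (p := fun f : L² => 𝓕⁻ f =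
      Lp.compMeasurePreserving (fun x : E => -x) (Measure.measurePreserving_neg volume) (𝓕 f : L²))
    (SchwartzMap.denseRange_toLpCLM (p := 2) ENNReal.ofNat_ne_top) f
    (isClosed_eq FourierTransform.continuous_fourierInv
      ((Lp.isometry_compMeasurePreserving _).continuous.comp FourierTransform.continuous_fourier))
    fun g => ?_
  simp only [SchwartzMap.toLpCLM_apply, SchwartzMap.toLp_fourierInv_eq,
    SchwartzMap.toLp_fourier_eq]
  apply Lp.ext
  filter_upwards [(𝓕⁻ g).coeFn_toLp 2 volume,
    Lp.coeFn_compMeasurePreserving ((𝓕 g).toLp 2 volume) (Measure.measurePreserving_neg volume),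
    (Measure.measurePreserving_neg (volume : Measure E)).quasiMeasurePreserving.ae
      ((𝓕 g).coeFn_toLp 2 volume)] with x hinv hneg hfwd
  rw [hinv, hneg, Function.comp_apply, hfwd, SchwartzMap.fourier_coe, SchwartzMap.fourierInv_coe,
    Real.fourierInv_eq_fourier_neg]

theorem eLpNorm_fourierInv (f : L²) (q : ℝ≥0∞) :
    eLpNorm (𝓕⁻ f : L²) q volume = eLpNorm (𝓕 f : L²) q volume := by
  rw [fourierInv_eq_compMeasurePreserving_neg_fourier,
    eLpNorm_congr_ae (Lp.coeFn_compMeasurePreserving _ _)]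
  exact eLpNorm_comp_measurePreserving (Lp.aestronglyMeasurable _)
    (Measure.measurePreserving_neg volume)

/-- The Hausdorff–Young inequality, with a constant that is not sharp. -/
theorem exists_eLpNorm_fourier_le {p q : ℝ≥0∞} (hp : 1 ≤ p) (hp₂ : p ≤ 2)
    [hpq : p.HolderConjugate q] :
    ∃ C : ℝ, 0 < C ∧ ∀ f : L²,
      eLpNorm (𝓕 f : L²) q volume ≤ ENNReal.ofReal C * eLpNorm f p volume := by
  rcases hp.eq_or_lt with rfl | hp
  · obtain rfl : q = ⊤ := ENNReal.HolderConjugate.unique 1 q ⊤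
    exact ⟨1, one_pos, fun f => by simpa using eLpNorm_fourier_top_le f⟩
  rcases hp₂.eq_or_lt with rfl | hp₂
  · obtain rfl : q = 2 := ENNReal.HolderConjugate.unique 2 q 2
    refine ⟨1, one_pos, fun f => ?_⟩
    rw [ENNReal.ofReal_one, one_mul, ← Lp.enorm_def, ← Lp.enorm_def, ← ofReal_norm, ← ofReal_norm,
      Lp.norm_fourier_eq]
  have hp_top : p ≠ ⊤ := hp₂.ne_top
  have hp' : 1 < p.toReal := by
    simpa using (ENNReal.toReal_lt_toReal ENNReal.one_ne_top hp_top).2 hp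
  have hp₂' : p.toReal < 2 := by
    simpa using (ENNReal.toReal_lt_toReal hp_top ENNReal.ofNat_ne_top).2 hp₂
  have hq_top : q ≠ ⊤ := (ENNReal.HolderConjugate.lt_top_iff_one_lt q p).2 hp |>.ne
  simpa only [ENNReal.ofReal_toReal hp_top, ENNReal.ofReal_toReal hq_top] using
    exists_eLpNorm_le_of_sup (T := fun f : L² => (𝓕 f : L²)) FourierTransform.fourier_add
      (fun f => (Lp.norm_fourier_eq f).le) eLpNorm_fourier_top_le hp' hp₂'
      (q := q.toReal) (ENNReal.HolderConjugate.toReal hp')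

/-- With `1/r = 1/p - 1/q`, Hölder's inequality places the symbol in `L^r` between two applications
of Hausdorff–Young, `L^p → L^p'` and `L^q' → L^q`. -/
theorem exists_eLpNorm_fourierInv_le {p q : ℝ≥0∞} (hp : 1 ≤ p) (hp₂ : p ≤ 2) (hq : 2 ≤ q) :
    ∃ C : ℝ, 0 < C ∧ ∀ (f g : L²) (m : E → ℝ), AEStronglyMeasurable m volume →
      (∀ᵐ k, ‖g k‖ ≤ m k * ‖(𝓕 f : L²) k‖) →
      eLpNorm (𝓕⁻ g : L²) q volume ≤
        ENNReal.ofReal C * eLpNorm m (p⁻¹ - q⁻¹)⁻¹ volume * eLpNorm f p volume := by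
  have hq₁ : 1 ≤ q := one_le_two.trans hq
  set p' : ℝ≥0∞ := (1 - p⁻¹)⁻¹ with hp'
  set q' : ℝ≥0∞ := (1 - q⁻¹)⁻¹ with hq'
  have hpp' : p.HolderConjugate p' := ENNReal.HolderConjugate.inv_one_sub_inv' hp
  have hqq' : q.HolderConjugate q' := ENNReal.HolderConjugate.inv_one_sub_inv' hq₁
  have hq'q : q'.HolderConjugate q := ENNReal.HolderConjugate.symm
  have hq'₁ : 1 ≤ q' := by rw [hq', ENNReal.one_le_inv]; exact tsub_le_self
  have hq'₂ : q' ≤ 2 := by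
    rw [hq', ENNReal.inv_le_iff_inv_le, ← ENNReal.one_sub_inv_two]
    exact tsub_le_tsub_left (ENNReal.inv_le_inv.2 hq) _
  have hholder : ENNReal.HolderTriple (p⁻¹ - q⁻¹)⁻¹ p' q' := ⟨by
    rw [hp', hq', inv_inv, inv_inv, inv_inv, add_comm, tsub_add_tsub_cancel (by simpa using hp)
      (ENNReal.inv_le_inv.2 (hp₂.trans hq))]⟩
  obtain ⟨C₁, hC₁, hHY₁⟩ := exists_eLpNorm_fourier_le (E := E) (F := F) (q := p') hp hp₂
  obtain ⟨C₂, hC₂, hHY₂⟩ := exists_eLpNorm_fourier_le (E := E) (F := F) (q := q) hq'₁ hq'₂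
  refine ⟨C₂ * C₁, by positivity, fun f g m hm hg => ?_⟩
  calc eLpNorm (𝓕⁻ g : L²) q volume = eLpNorm (𝓕 g : L²) q volume := eLpNorm_fourierInv g q
    _ ≤ ENNReal.ofReal C₂ * eLpNorm g q' volume := hHY₂ g
    _ ≤ ENNReal.ofReal C₂ * eLpNorm (m • fun k => ‖(𝓕 f : L²) k‖) q' volume := by
      gcongr 1
      exact eLpNorm_mono_ae (hg.mono fun k hk => hk.trans (le_abs_self _))
    _ ≤ ENNReal.ofReal C₂ *
        (eLpNorm m (p⁻¹ - q⁻¹)⁻¹ volume * eLpNorm (fun k => ‖(𝓕 f : L²) k‖) p' volume) := by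
      gcongr 1
      exact eLpNorm_smul_le_mul_eLpNorm (Lp.aestronglyMeasurable (𝓕 f : L²)).norm hm
    _ ≤ ENNReal.ofReal C₂ *
        (eLpNorm m (p⁻¹ - q⁻¹)⁻¹ volume * (ENNReal.ofReal C₁ * eLpNorm f p volume)) := by
      rw [eLpNorm_norm]
      gcongr
      exact hHY₁ f
    _ = _ := by rw [ENNReal.ofReal_mul hC₂.le]; ring

end HausdorffYoung

section SymbolNorms

variable {E : Type*} [NormedAddCommGroup E] [InnerProductSpace ℝ E] [FiniteDimensional ℝ E]
  [MeasurableSpace E] [BorelSpace E]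

theorem memLp_one_add_norm_smul_sq_rpow {ρ : ℝ≥0∞} {s a : ℝ} (ha : a ≠ 0)
    (hs : Module.finrank ℝ E * ρ.toReal < s) :
    MemLp (fun k : E => (1 + ‖a • k‖ ^ 2) ^ (-(s / 2))) ρ⁻¹ volume := by
  have hmeas : AEStronglyMeasurable (fun k : E => (1 + ‖a • k‖ ^ 2) ^ (-(s / 2))) volume :=
    Measurable.aestronglyMeasurable (by fun_prop)
  have hbound : ∀ k : E, ‖(1 + ‖a • k‖ ^ 2) ^ (-(s / 2))‖ ≤ 1 := fun k => by
    have hs₀ : 0 ≤ s := le_trans (by positivity) hs.le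
    rw [Real.norm_of_nonneg (by positivity)]
    exact Real.rpow_le_one_of_one_le_of_nonpos (by simp) (by linarith)
  rcases eq_or_ne ρ 0 with rfl | hρ₀
  · rw [ENNReal.inv_zero]
    exact memLp_top_of_bound hmeas 1 (ae_of_all _ hbound)
  rcases eq_or_ne ρ ⊤ with rfl | hρ
  · rw [ENNReal.inv_top]
    exact memLp_zero_iff_aestronglyMeasurable.2 hmeas
  have hρ_pos : 0 < ρ.toReal := ENNReal.toReal_pos hρ₀ hρ
  rw [← integrable_norm_rpow_iff hmeas (by simpa using hρ) (by simpa using hρ₀)]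
  refine ((integrable_rpow_neg_one_add_norm_sq (E := E) (μ := volume)
    ((lt_div_iff₀ hρ_pos).2 hs)).comp_smul ha).congr (ae_of_all _ fun k => ?_)
  simp only [ENNReal.toReal_inv]
  rw [Real.norm_of_nonneg (by positivity), ← Real.rpow_mul (by positivity)]
  congr 1
  field_simp

theorem integrable_exp_neg_mul_norm_sq {b : ℝ} (hb : 0 < b) :
    Integrable (fun k : E => Real.exp (-b * ‖k‖ ^ 2)) :=
  .of_integral_ne_zero <| by
    rw [GaussianFourier.integral_rexp_neg_mul_sq_norm hb]
    positivity

theorem eLpNorm_exp_neg_mul_norm_sq_le {ρ : ℝ≥0∞} (hρ : ρ ≠ ⊤) {b : ℝ} (hb : 0 < b) :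
    eLpNorm (fun k : E => Real.exp (-b * ‖k‖ ^ 2)) ρ⁻¹ volume ≤
      ENNReal.ofReal ((Real.pi * ρ.toReal / b) ^ (Module.finrank ℝ E / 2 * ρ.toReal)) := by
  rcases eq_or_ne ρ 0 with rfl | hρ₀
  · simp only [ENNReal.inv_zero, ENNReal.toReal_zero, mul_zero, Real.rpow_zero,
      ENNReal.ofReal_one, eLpNorm_exponent_top]
    refine eLpNormEssSup_le_of_ae_enorm_bound (ae_of_all _ fun k => ?_)
    rw [← ofReal_norm, Real.norm_of_nonneg (Real.exp_pos _).le, ENNReal.ofReal_le_one,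
      Real.exp_le_one_iff, neg_mul, neg_nonpos]
    positivity
  have hρ_pos : 0 < ρ.toReal := ENNReal.toReal_pos hρ₀ hρ
  have hpow : ∀ k : E, ‖Real.exp (-b * ‖k‖ ^ 2)‖ₑ ^ (ρ⁻¹).toReal =
      ENNReal.ofReal (Real.exp (-(b / ρ.toReal) * ‖k‖ ^ 2)) := fun k => by
    rw [← ofReal_norm, Real.norm_of_nonneg (Real.exp_pos _).le,
      ENNReal.ofReal_rpow_of_pos (Real.exp_pos _), ← Real.exp_mul, ENNReal.toReal_inv]
    congr 2
    ring
  rw [eLpNorm_eq_lintegral_rpow_enorm_toReal (by simpa using hρ) (by simpa using hρ₀)]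
  simp only [hpow]
  rw [← ofReal_integral_eq_lintegral_ofReal (integrable_exp_neg_mul_norm_sq (by positivity))
      (ae_of_all _ fun k => (Real.exp_pos _).le),
    GaussianFourier.integral_rexp_neg_mul_sq_norm (by positivity), ENNReal.toReal_inv, one_div,
    inv_inv, ENNReal.ofReal_rpow_of_pos (by positivity), ← Real.rpow_mul (by positivity),
    div_div_eq_mul_div]

end SymbolNorms

section Lyapunov

open Matrix
open scoped ComplexOrder MatrixOrder

variable {m : Type*} [Fintype m] {S P X : Matrix m m ℂ}

/-- `tr (Xᴴ X)` is real, but for skew `S` the trace of `Xᴴ ⁅X, S⁆` is purely imaginary. -/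
theorem eq_zero_of_lie_eq_self (hS : Sᴴ = -S) (hX : ⁅X, S⁆ = X) : X = 0 := by
  have hreal : star (Xᴴ * X).trace = (Xᴴ * X).trace := by
    rw [← trace_conjTranspose, conjTranspose_mul, conjTranspose_conjTranspose]
  have himag : star (Xᴴ * ⁅X, S⁆).trace = -(Xᴴ * ⁅X, S⁆).trace := by
    have hcycle : (S * (Xᴴ * X)).trace = (Xᴴ * (X * S)).trace := by
      rw [trace_mul_comm, Matrix.mul_assoc]
    rw [← trace_conjTranspose, Ring.lie_def]
    simp only [conjTranspose_mul, conjTranspose_sub, conjTranspose_conjTranspose, hS,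
      Matrix.mul_sub, Matrix.neg_mul, Matrix.mul_neg, trace_sub, trace_neg,
      Matrix.mul_assoc, hcycle]
    ring
  rw [hX, hreal, self_eq_neg] at himag
  exact trace_conjTranspose_mul_self_eq_zero_iff.1 himag

theorem exists_sub_lie_eq (hS : Sᴴ = -S) (P : Matrix m m ℂ) : ∃ X, X - ⁅X, S⁆ = P := by
  let L : Matrix m m ℂ →ₗ[ℂ] Matrix m m ℂ := LinearMap.id - LinearMap.mulRight ℂ S +
    LinearMap.mulLeft ℂ S
  have hL : ∀ X, L X = X - ⁅X, S⁆ := fun X => by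
    simp [L, Ring.lie_def, sub_add]
  have hinj : Function.Injective L := by
    refine (injective_iff_map_eq_zero L).2 fun X hX => eq_zero_of_lie_eq_self hS ?_
    rw [hL, sub_eq_zero] at hX
    exact hX.symm
  obtain ⟨X, hX⟩ := LinearMap.injective_iff_surjective.1 hinj P
  exact ⟨X, by rw [← hL, hX]⟩

theorem isHermitian_of_sub_lie_eq (hS : Sᴴ = -S) (hP : P.IsHermitian) (hX : X - ⁅X, S⁆ = P) :
    X.IsHermitian := by
  have hXH : Xᴴ - ⁅Xᴴ, S⁆ = P := by
    rw [← hP.eq, ← hX, Ring.lie_def, Ring.lie_def]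
    simp only [conjTranspose_sub, conjTranspose_mul, hS, Matrix.neg_mul, Matrix.mul_neg]
    abel
  refine sub_eq_zero.1 (eq_zero_of_lie_eq_self hS ?_)
  have hdiff := sub_eq_zero.2 (hXH.trans hX.symm)
  rw [← sub_eq_zero, ← neg_eq_zero, ← hdiff]
  simp only [Ring.lie_def, Matrix.sub_mul, Matrix.mul_sub]
  abel

theorem posSemidef_of_sub_lie_eq (hS : Sᴴ = -S) (hP : P.PosSemidef) (hX : X - ⁅X, S⁆ = P) :
    X.PosSemidef := by
  classical
  have hXH : X.IsHermitian := isHermitian_of_sub_lie_eq hS hP.isHermitian hX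
  refine hXH.posSemidef_iff_eigenvalues_nonneg.2 fun i => ?_
  set w : m → ℂ := ⇑(hXH.eigenvectorBasis i)
  have hw : X *ᵥ w = (hXH.eigenvalues i : ℂ) • w := by
    simpa using hXH.mulVec_eigenvectorBasis i
  have hw_left : star w ᵥ* X = (hXH.eigenvalues i : ℂ) • star w := by
    have hstar := congrArg star hw
    rwa [star_mulVec, hXH.eq, star_smul, RCLike.star_def, Complex.conj_ofReal] at hstar
  have hlie : star w ⬝ᵥ (⁅X, S⁆ *ᵥ w) = 0 := by
    rw [Ring.lie_def, Matrix.sub_mulVec, dotProduct_sub, ← mulVec_mulVec, ← mulVec_mulVec,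
      dotProduct_mulVec (star w) X, hw_left, hw, mulVec_smul, smul_dotProduct, dotProduct_smul,
      sub_self]
  have hnorm : star w ⬝ᵥ w = 1 := by
    rw [dotProduct_comm, ← EuclideanSpace.inner_eq_star_dotProduct, inner_self_eq_norm_sq_to_K,
      hXH.eigenvectorBasis.orthonormal.1 i, RCLike.ofReal_one, one_pow]
  have hval : (hXH.eigenvalues i : ℂ) = star w ⬝ᵥ (P *ᵥ w) := by
    rw [← hX, Matrix.sub_mulVec, dotProduct_sub, hlie, sub_zero, hw, dotProduct_smul, hnorm,
      smul_eq_mul, mul_one]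
  simpa [← hval] using hP.re_dotProduct_nonneg w

theorem exists_mulVec_eq_smul_mem {V : Submodule ℂ (m → ℂ)} (hV : V ≠ ⊥)
    (hS : ∀ v ∈ V, S *ᵥ v ∈ V) : ∃ v ∈ V, v ≠ 0 ∧ ∃ z : ℂ, S *ᵥ v = z • v := by
  have : Nontrivial V := Submodule.nontrivial_iff_ne_bot.2 hV
  obtain ⟨z, hz⟩ := Module.End.exists_eigenvalue (S.mulVecLin.restrict hS)
  obtain ⟨v, hv⟩ := hz.exists_hasEigenvector
  exact ⟨v, v.2, by simpa using hv.2, z, congrArg Subtype.val hv.apply_eq_smul⟩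

/-- The kernel of the solution `X` of the Lyapunov equation is an `S`-invariant subspace of
`ker P`. -/
theorem posDef_of_sub_lie_eq (hS : Sᴴ = -S) (hP : P.PosSemidef)
    (hSP : ∀ (z : ℂ) (v : m → ℂ), S *ᵥ v = z • v → P *ᵥ v = 0 → v = 0) (hX : X - ⁅X, S⁆ = P) :
    X.PosDef := by
  classical
  have hXP : X.PosSemidef := posSemidef_of_sub_lie_eq hS hP hX
  have happly : ∀ v, X *ᵥ v - (X *ᵥ (S *ᵥ v) - S *ᵥ (X *ᵥ v)) = P *ᵥ v := fun v => by
    rw [← hX, Ring.lie_def, Matrix.sub_mulVec, Matrix.sub_mulVec, mulVec_mulVec, mulVec_mulVec]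
  have hkerP : ∀ v, X *ᵥ v = 0 → P *ᵥ v = 0 := fun v hv => by
    rw [← hP.dotProduct_mulVec_zero_iff, ← happly, hv, mulVec_zero, sub_zero, zero_sub,
      dotProduct_neg, dotProduct_mulVec, ← hXP.isHermitian.eq, ← star_mulVec, hv, star_zero,
      zero_dotProduct, neg_zero]
  have hinv : ∀ v ∈ LinearMap.ker X.mulVecLin, S *ᵥ v ∈ LinearMap.ker X.mulVecLin := by
    intro v (hv : X *ᵥ v = 0)
    change X *ᵥ (S *ᵥ v) = 0
    have hSv := happly v
    rwa [hkerP v hv, hv, mulVec_zero, sub_zero, zero_sub, neg_eq_zero] at hSv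
  have hker : LinearMap.ker X.mulVecLin = ⊥ := by
    by_contra hne
    obtain ⟨v, hv, hv₀, z, hz⟩ := exists_mulVec_eq_smul_mem hne hinv
    exact hv₀ (hSP z v hz (hkerP v hv))
  exact hXP.posDef_iff_isUnit.2 (mulVec_injective_iff_isUnit.1 (LinearMap.ker_eq_bot.1 hker))

end Lyapunov

section Compensator

open Topology

variable {E : Type*} [NormedAddCommGroup E] [InnerProductSpace ℂ E] {S P X : E →L[ℂ] E} {C : ℝ}

/-- `X` is a compensator of size at most `C` for the skew operator `S` and the dissipation `P`
(in the sense of Shizuta and Kawashima): the commutator with `S` restores the coercivity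
which `P` lacks. -/
structure IsCompensator (S P X : E →L[ℂ] E) (C : ℝ) : Prop where
  norm_le : ‖X‖ ≤ C
  norm_sq_le : ∀ w, ‖w‖ ^ 2 ≤ (inner ℂ w (⁅X, S⁆ w)).re + C * (inner ℂ w (P w)).re

namespace IsCompensator

theorem nonneg (h : IsCompensator S P X C) : 0 ≤ C :=
  (norm_nonneg X).trans h.norm_le

theorem mono (h : IsCompensator S P X C) (hP : ∀ w, 0 ≤ (inner ℂ w (P w)).re) {C' : ℝ}
    (hC : C ≤ C') : IsCompensator S P X C' where
  norm_le := h.norm_le.trans hC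
  norm_sq_le w := (h.norm_sq_le w).trans (by gcongr; exact hP w)

theorem eventually_two_smul (h : IsCompensator S P X C) :
    ∀ᶠ T in 𝓝 S, IsCompensator T P ((2 : ℂ) • X) (2 * C) := by
  have hcont : ContinuousAt (fun T => ‖⁅(2 : ℂ) • X, T - S⁆‖) S := by
    simp only [Ring.lie_def]
    fun_prop
  have hnear : ∀ᶠ T in 𝓝 S, ‖⁅(2 : ℂ) • X, T - S⁆‖ ≤ 1 :=
    hcont.eventually_le_const (by simp [Ring.lie_def])
  filter_upwards [hnear] with T hT
  refine ⟨by simpa [norm_smul] using h.norm_le, fun w => ?_⟩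
  have hsplit : ⁅(2 : ℂ) • X, T⁆ = (2 : ℂ) • ⁅X, S⁆ + ⁅(2 : ℂ) • X, T - S⁆ := by
    simp only [Ring.lie_def, smul_sub, mul_sub, sub_mul, smul_mul_assoc, mul_smul_comm]
    abel
  have hsmall : |(inner ℂ w (⁅(2 : ℂ) • X, T - S⁆ w)).re| ≤ ‖w‖ ^ 2 := by
    refine (Complex.abs_re_le_norm _).trans ((norm_inner_le_norm _ _).trans ?_)
    have hTw := ContinuousLinearMap.le_of_opNorm_le _ hT w
    nlinarith [norm_nonneg w]
  have hS := h.norm_sq_le w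
  rw [hsplit, _root_.add_apply, _root_.smul_apply, inner_add_right, inner_smul_right,
    Complex.add_re, Complex.mul_re, Complex.re_ofNat, Complex.im_ofNat, zero_mul, sub_zero]
  linarith [neg_le_of_abs_le hsmall]

end IsCompensator

theorem exists_forall_isCompensator (hP : ∀ w, 0 ≤ (inner ℂ w (P w)).re)
    {K : Set (E →L[ℂ] E)} (hK : IsCompact K) (h : ∀ S ∈ K, ∃ X C, IsCompensator S P X C) :
    ∃ C, 0 < C ∧ ∀ S ∈ K, ∃ X, IsCompensator S P X C := by
  refine hK.induction_on (p := fun K => ∃ C, 0 < C ∧ ∀ S ∈ K, ∃ X, IsCompensator S P X C)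
    ⟨1, one_pos, by simp⟩ (fun s t hst ⟨C, hC, ht⟩ => ⟨C, hC, fun S hS => ht S (hst hS)⟩) ?_ ?_
  · rintro s t ⟨C, hC, hs⟩ ⟨C', -, ht⟩
    refine ⟨max C C', lt_max_of_lt_left hC, ?_⟩
    rintro S (hS | hS)
    · obtain ⟨X, hX⟩ := hs S hS
      exact ⟨X, hX.mono hP (le_max_left _ _)⟩
    · obtain ⟨X, hX⟩ := ht S hS
      exact ⟨X, hX.mono hP (le_max_right _ _)⟩
  · intro S hS
    obtain ⟨X, C, hX⟩ := h S hS
    refine ⟨_, mem_nhdsWithin_of_mem_nhds hX.eventually_two_smul, 2 * C + 1,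
      by linarith [hX.nonneg], fun T hT => ⟨_, IsCompensator.mono hT hP (by linarith)⟩⟩

end Compensator

section LyapunovCompensator

open Matrix
open scoped ComplexOrder MatrixOrder

variable {m : Type*} [Fintype m] [DecidableEq m] {S P X : Matrix m m ℂ}

theorem inner_toEuclideanCLM_apply (X : Matrix m m ℂ) (v w : EuclideanSpace ℂ m) :
    inner ℂ v (toEuclideanCLM (𝕜 := ℂ) X w) = star v.ofLp ⬝ᵥ (X *ᵥ w.ofLp) := by
  rw [EuclideanSpace.inner_eq_star_dotProduct, ofLp_toEuclideanCLM, dotProduct_comm]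

theorem exists_pos_mul_norm_sq_le_of_posDef (hX : X.PosDef) :
    ∃ c : ℝ, 0 < c ∧ ∀ w : EuclideanSpace ℂ m,
      c * ‖w‖ ^ 2 ≤ (inner ℂ w (toEuclideanCLM (𝕜 := ℂ) X w)).re := by
  rcases isEmpty_or_nonempty m with hm | hm
  · exact ⟨1, one_pos, fun w => by simp [Subsingleton.elim w 0]⟩
  obtain ⟨c, hc, hcX⟩ := (CFC.exists_pos_algebraMap_le_iff hX.isHermitian.isSelfAdjoint).2
    fun x hx => hX.isStrictlyPositive.spectrum_pos hx
  refine ⟨c, hc, fun w => ?_⟩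
  have hpos := (Matrix.le_iff.1 hcX).re_dotProduct_nonneg w.ofLp
  rw [Matrix.sub_mulVec, dotProduct_sub, ← inner_toEuclideanCLM_apply,
    ← inner_toEuclideanCLM_apply] at hpos
  have hsmul : toEuclideanCLM (𝕜 := ℂ) (algebraMap ℝ (Matrix m m ℂ) c) w =
      (c : ℂ) • w := by
    ext i
    simp [ofLp_toEuclideanCLM, algebraMap_eq_diagonal, mulVec_diagonal]
  rw [hsmul, inner_smul_right, RCLike.re_to_complex, Complex.sub_re, Complex.re_ofReal_mul,
    ← RCLike.re_to_complex, ← RCLike.re_to_complex, inner_self_eq_norm_sq] at hpos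
  exact sub_nonneg.1 hpos

/-- The compensator is the normalised solution of the Lyapunov equation. -/
theorem exists_isCompensator (hS : Sᴴ = -S) (hP : P.PosSemidef)
    (hSP : ∀ (z : ℂ) (v : m → ℂ), S *ᵥ v = z • v → P *ᵥ v = 0 → v = 0) :
    ∃ X C, IsCompensator (toEuclideanCLM (𝕜 := ℂ) S)
      (toEuclideanCLM (𝕜 := ℂ) P) X C := by
  obtain ⟨X, hX⟩ := exists_sub_lie_eq hS P
  obtain ⟨c, hc, hcX⟩ := exists_pos_mul_norm_sq_le_of_posDef (posDef_of_sub_lie_eq hS hP hSP hX)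
  set T := toEuclideanCLM (n := m) (𝕜 := ℂ)
  have hTX : T X - ⁅T X, T S⁆ = T P := by
    rw [← hX]
    simp only [Ring.lie_def, map_sub, map_mul]
  have hP' : ∀ w, 0 ≤ (inner ℂ w (T P w)).re := fun w => by
    rw [inner_toEuclideanCLM_apply]
    exact hP.re_dotProduct_nonneg _
  refine ⟨(c⁻¹ : ℂ) • T X, max ‖(c⁻¹ : ℂ) • T X‖ c⁻¹, le_max_left _ _, fun w => ?_⟩
  have hw : c * ‖w‖ ^ 2 ≤ (inner ℂ w (⁅T X, T S⁆ w)).re + (inner ℂ w (T P w)).re := by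
    refine (hcX w).trans_eq ?_
    rw [← Complex.add_re, ← inner_add_right, ← _root_.add_apply, ← hTX,
      add_sub_cancel]
  have hlie : ⁅(c⁻¹ : ℂ) • T X, T S⁆ w = ((c⁻¹ : ℝ) : ℂ) • ⁅T X, T S⁆ w := by
    simp [Ring.lie_def, smul_sub]
  calc ‖w‖ ^ 2 = c⁻¹ * (c * ‖w‖ ^ 2) := by field_simp
    _ ≤ c⁻¹ * ((inner ℂ w (⁅T X, T S⁆ w)).re + (inner ℂ w (T P w)).re) := by gcongr
    _ = (inner ℂ w (⁅(c⁻¹ : ℂ) • T X, T S⁆ w)).re + c⁻¹ * (inner ℂ w (T P w)).re := by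
        rw [hlie, inner_smul_right, Complex.re_ofReal_mul, mul_add]
    _ ≤ _ := by gcongr; exacts [hP' w, le_max_right _ _]

end LyapunovCompensator

section Dissipation

theorem le_mul_exp_of_hasDerivWithinAt_le {f f' : ℝ → ℝ} {a : ℝ}
    (hf : ∀ t, 0 ≤ t → HasDerivWithinAt f (f' t) (Set.Ici 0) t)
    (hf' : ∀ t, 0 ≤ t → f' t ≤ -a * f t) {t : ℝ} (ht : 0 ≤ t) :
    f t ≤ f 0 * Real.exp (-a * t) := by
  have hcont : ContinuousOn f (Set.Icc 0 t) := fun s hs =>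
    (hf s hs.1).continuousWithinAt.mono Set.Icc_subset_Ici_self
  have hslope : ∀ s ∈ Set.Ico 0 t, ∀ r, f' s < r →
      ∃ᶠ z in nhdsWithin s (Set.Ioi s), (z - s)⁻¹ * (f z - f s) < r := fun s hs r hr =>
    ((hf s hs.1).mono (Set.Ici_subset_Ici.2 hs.1)).liminf_right_slope_le hr
  have hgronwall := le_gronwallBound_of_liminf_deriv_right_le (ε := 0) hcont hslope le_rfl
    (fun s hs => (hf' s hs.1).trans_eq (add_zero _).symm) t ⟨ht, le_rfl⟩
  rwa [gronwallBound_ε0, sub_zero] at hgronwall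

variable {E : Type*} [NormedAddCommGroup E] [InnerProductSpace ℂ E] {S P X : E →L[ℂ] E}
  {C κ ρ ε : ℝ}

theorem re_inner_apply_self_of_skew (hS : ∀ v w, inner ℂ (S v) w = -inner ℂ v (S w)) (w : E) :
    (inner ℂ w (S w)).re = 0 := by
  have hconj := congrArg Complex.re (inner_conj_symm w (S w))
  rw [hS, Complex.conj_re, Complex.neg_re] at hconj
  linarith

theorem inner_lie_apply_of_skew (hS : ∀ v w, inner ℂ (S v) w = -inner ℂ v (S w)) (w : E) :
    inner ℂ w (⁅X, S⁆ w) = inner ℂ w (X (S w)) + inner ℂ (S w) (X w) := by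
  rw [hS, ← sub_eq_add_neg, ← inner_sub_right]
  rfl

theorem abs_re_inner_apply_le (hX : ‖X‖ ≤ C) (v w : E) :
    |(inner ℂ v (X w)).re| ≤ C * (‖v‖ * ‖w‖) :=
  calc |(inner ℂ v (X w)).re| ≤ ‖v‖ * ‖X w‖ :=
        (Complex.abs_re_le_norm _).trans (norm_inner_le_norm _ _)
    _ ≤ ‖v‖ * (C * ‖w‖) := by gcongr; exact X.le_of_opNorm_le hX w
    _ = C * (‖v‖ * ‖w‖) := by ring

/-- The squared norm, perturbed by a multiple of the quadratic form of a compensator `X`. -/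
def energy (X : E →L[ℂ] E) (ε : ℝ) (w : E) : ℝ :=
  ‖w‖ ^ 2 - ε * (inner ℂ w (X w)).re

theorem abs_energy_sub_norm_sq_le (hX : ‖X‖ ≤ C) (hε : 0 ≤ ε) (hεC : ε * C ≤ 1 / 2) (w : E) :
    |energy X ε w - ‖w‖ ^ 2| ≤ 1 / 2 * ‖w‖ ^ 2 := by
  rw [energy, sub_sub_cancel_left, abs_neg, abs_mul, abs_of_nonneg hε]
  calc ε * |(inner ℂ w (X w)).re| ≤ ε * (C * (‖w‖ * ‖w‖)) := by
        gcongr; exact abs_re_inner_apply_le hX w w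
    _ = ε * C * ‖w‖ ^ 2 := by ring
    _ ≤ 1 / 2 * ‖w‖ ^ 2 := by gcongr

/-- The derivative of the energy at `w` in the direction `v`. -/
def energyDeriv (X : E →L[ℂ] E) (ε : ℝ) (w v : E) : ℝ :=
  2 * (inner ℂ w v).re - ε * ((inner ℂ w (X v)).re + (inner ℂ v (X w)).re)

theorem hasDerivWithinAt_energy {w : ℝ → E} {w' : E} {s : Set ℝ} {t : ℝ}
    (hw : HasDerivWithinAt w w' s t) :
    HasDerivWithinAt (fun t => energy X ε (w t)) (energyDeriv X ε (w t) w') s t := by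
  have hXw : HasDerivWithinAt (fun t => X (w t)) (X w') s t :=
    (X.restrictScalars ℝ).hasFDerivAt.comp_hasDerivWithinAt t hw
  have hre : ∀ {f : ℝ → ℂ} {f' : ℂ}, HasDerivWithinAt f f' s t →
      HasDerivWithinAt (fun t => (f t).re) f'.re s t := fun hf =>
    Complex.reCLM.hasFDerivAt.comp_hasDerivWithinAt t hf
  have hnorm : ∀ t, ‖w t‖ ^ 2 = (inner ℂ (w t) (w t)).re := fun t =>
    (inner_self_eq_norm_sq (𝕜 := ℂ) (w t)).symm
  simp only [energy, hnorm]
  refine ((hre (hw.inner ℂ hw)).sub ((hre (hw.inner ℂ hXw)).const_mul ε)).congr_deriv ?_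
  rw [energyDeriv, Complex.add_re, Complex.add_re, ← inner_conj_symm w' (w t), Complex.conj_re]
  ring

/-- The generator `ρ S - κ ρ² P` of the flow at frequency `ρ`, with skew part `S`, damped only in
the range of `P`. -/
def dampedGenerator (S P : E →L[ℂ] E) (κ ρ : ℝ) : E →L[ℂ] E :=
  (ρ : ℂ) • S - ((κ * ρ ^ 2 : ℝ) : ℂ) • P

theorem energyDeriv_dampedGenerator (hS : ∀ v w, inner ℂ (S v) w = -inner ℂ v (S w)) (w : E) :
    energyDeriv X ε w (dampedGenerator S P κ ρ w) =
      -(2 * κ * ρ ^ 2 * (inner ℂ w (P w)).re) - ε * ρ * (inner ℂ w (⁅X, S⁆ w)).re +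
        ε * κ * ρ ^ 2 * ((inner ℂ w (X (P w))).re + (inner ℂ (P w) (X w)).re) := by
  have hSw := re_inner_apply_self_of_skew hS w
  simp only [energyDeriv, dampedGenerator, _root_.sub_apply, _root_.smul_apply, map_sub, map_smul,
    inner_sub_right, inner_sub_left, inner_smul_right, inner_smul_left, Complex.conj_ofReal,
    Complex.sub_re, Complex.re_ofReal_mul, hSw, inner_lie_apply_of_skew hS, Complex.add_re]
  ring

/-- The relaxation rate at high frequencies of `ρ S - κ ρ² P` when `S` has a compensator of
size `C`. -/
def relaxationRate (C κ : ℝ) : ℝ :=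
  min (1 / (2 * C)) (κ / (C + 2 * κ ^ 2 * C ^ 2))

theorem relaxationRate_pos (hC : 0 < C) (hκ : 0 < κ) : 0 < relaxationRate C κ :=
  lt_min (by positivity) (by positivity)

theorem relaxationRate_mul_le_half (hC : 0 < C) : relaxationRate C κ * C ≤ 1 / 2 :=
  calc relaxationRate C κ * C ≤ 1 / (2 * C) * C := by gcongr; exact min_le_left _ _
    _ = 1 / 2 := by field_simp

theorem relaxationRate_mul_le (hC : 0 < C) :
    relaxationRate C κ * (C + 2 * κ ^ 2 * C ^ 2) ≤ κ :=
  (le_div_iff₀ (by positivity)).1 (min_le_right _ _)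

/-- The cross terms with `P w` are absorbed by the dissipation `2 κ ρ² ⟪w, P w⟫` and by half of
the coercivity gained from the commutator. -/
theorem IsCompensator.energyDeriv_le (h : IsCompensator S P X C)
    (hS : ∀ v w, inner ℂ (S v) w = -inner ℂ v (S w))
    (hP : ∀ w, ‖P w‖ ^ 2 ≤ (inner ℂ w (P w)).re) (hC : 0 < C) (hκ : 0 < κ) (hρ : 0 < ρ) (w : E) :
    energyDeriv X (relaxationRate C κ * min 1 (ρ ^ 2) / ρ) w (dampedGenerator S P κ ρ w) ≤
      -(relaxationRate C κ * min 1 (ρ ^ 2) / 2 * ‖w‖ ^ 2) := by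
  set b := relaxationRate C κ
  set m := min 1 (ρ ^ 2)
  set p := (inner ℂ w (P w)).re
  have hb : 0 < b := relaxationRate_pos hC hκ
  have hm : 0 < m := by positivity
  have hp : 0 ≤ p := (sq_nonneg _).trans (hP w)
  have hcross : (inner ℂ w (X (P w))).re + (inner ℂ (P w) (X w)).re ≤ 2 * C * (‖w‖ * ‖P w‖) := by
    linarith [le_of_abs_le (abs_re_inner_apply_le h.norm_le w (P w)),
      le_of_abs_le (abs_re_inner_apply_le h.norm_le (P w) w), mul_comm ‖w‖ ‖P w‖]
  have hyoung : 2 * C * κ * ρ * (‖w‖ * ‖P w‖) ≤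
      1 / 2 * ‖w‖ ^ 2 + 2 * κ ^ 2 * C ^ 2 * ρ ^ 2 * p := by
    have hPw : 2 * κ ^ 2 * C ^ 2 * ρ ^ 2 * ‖P w‖ ^ 2 ≤ 2 * κ ^ 2 * C ^ 2 * ρ ^ 2 * p := by
      gcongr; exact hP w
    linarith [sq_nonneg (‖w‖ - 2 * C * κ * ρ * ‖P w‖)]
  have habsorb : b * m * (C + 2 * κ ^ 2 * C ^ 2 * ρ ^ 2) ≤ κ * ρ ^ 2 :=
    calc b * m * (C + 2 * κ ^ 2 * C ^ 2 * ρ ^ 2)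
        = b * (C * m + 2 * κ ^ 2 * C ^ 2 * ρ ^ 2 * m) := by ring
      _ ≤ b * (C * ρ ^ 2 + 2 * κ ^ 2 * C ^ 2 * ρ ^ 2 * 1) := by
          gcongr; exacts [min_le_right _ _, min_le_left _ _]
      _ = b * (C + 2 * κ ^ 2 * C ^ 2) * ρ ^ 2 := by ring
      _ ≤ κ * ρ ^ 2 := by gcongr; exact relaxationRate_mul_le hC
  rw [energyDeriv_dampedGenerator hS]
  calc _ ≤ -(2 * κ * ρ ^ 2 * p) - b * m / ρ * ρ * (‖w‖ ^ 2 - C * p) +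
        b * m / ρ * κ * ρ ^ 2 * (2 * C * (‖w‖ * ‖P w‖)) := by
        gcongr; linarith [h.norm_sq_le w]
    _ = -(2 * κ * ρ ^ 2 * p) - b * m * (‖w‖ ^ 2 - C * p) +
        b * m * (2 * C * κ * ρ * (‖w‖ * ‖P w‖)) := by field_simp
    _ ≤ -(2 * κ * ρ ^ 2 * p) - b * m * (‖w‖ ^ 2 - C * p) +
        b * m * (1 / 2 * ‖w‖ ^ 2 + 2 * κ ^ 2 * C ^ 2 * ρ ^ 2 * p) := by gcongr
    _ = -(b * m / 2 * ‖w‖ ^ 2) - (2 * (κ * ρ ^ 2) - b * m * (C + 2 * κ ^ 2 * C ^ 2 * ρ ^ 2)) * p :=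
        by ring
    _ ≤ -(b * m / 2 * ‖w‖ ^ 2) := sub_le_self _ <| mul_nonneg
        (by linarith [mul_pos hκ (pow_pos hρ 2)]) hp

theorem IsCompensator.norm_sq_flow_le (h : IsCompensator S P X C)
    (hS : ∀ v w, inner ℂ (S v) w = -inner ℂ v (S w))
    (hP : ∀ w, ‖P w‖ ^ 2 ≤ (inner ℂ w (P w)).re) (hC : 0 < C) (hκ : 0 < κ) (hρ : 0 < ρ)
    {w : ℝ → E}
    (hw : ∀ t, 0 ≤ t → HasDerivWithinAt w (dampedGenerator S P κ ρ (w t)) (Set.Ici 0) t)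
    {t : ℝ} (ht : 0 ≤ t) :
    ‖w t‖ ^ 2 ≤ 3 * ‖w 0‖ ^ 2 * Real.exp (-(relaxationRate C κ / 3 * min 1 (ρ ^ 2)) * t) := by
  set b := relaxationRate C κ
  set m := min 1 (ρ ^ 2)
  have hb : 0 < b := relaxationRate_pos hC hκ
  have hm : 0 < m := by positivity
  have hmρ : m ≤ ρ := by
    rcases le_total 1 ρ with h1 | h1
    · exact (min_le_left _ _).trans h1
    · exact (min_le_right _ _).trans (by nlinarith)
  have hεC : b * m / ρ * C ≤ 1 / 2 :=
    calc b * m / ρ * C = b * C * (m / ρ) := by ring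
      _ ≤ b * C * 1 := by gcongr; exact (div_le_one hρ).2 hmρ
      _ ≤ 1 / 2 := by rw [mul_one]; exact relaxationRate_mul_le_half hC
  have hequiv := fun w => abs_le.1 (abs_energy_sub_norm_sq_le h.norm_le (by positivity) hεC w)
  have hdecay := le_mul_exp_of_hasDerivWithinAt_le (a := b / 3 * m)
    (fun t ht => hasDerivWithinAt_energy (hw t ht)) (fun t _ => by
      refine (h.energyDeriv_le hS hP hC hκ hρ (w t)).trans ?_
      have hupper := mul_le_mul_of_nonneg_left (hequiv (w t)).2 (mul_pos hb hm).le
      linarith) ht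
  have hinit : energy X (b * m / ρ) (w 0) * Real.exp (-(b / 3 * m) * t) ≤
      3 / 2 * ‖w 0‖ ^ 2 * Real.exp (-(b / 3 * m) * t) := by
    gcongr; linarith [(hequiv (w 0)).2]
  linarith [(hequiv (w t)).1]

end Dissipation

namespace ThermoElastic

open Matrix

section Symmetrization

open scoped ComplexOrder

variable {ι : Type*}

/-- The projection onto the temperature component, the only one which is damped. -/
def dissipationMatrix (ι : Type*) : Matrix (ι ⊕ Unit) (ι ⊕ Unit) ℂ :=
  fromBlocks 0 0 0 1

theorem posSemidef_dissipationMatrix : (dissipationMatrix ι).PosSemidef := by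
  classical
  have hdiag : dissipationMatrix ι = diagonal (Sum.elim 0 1) := by
    rw [dissipationMatrix, ← fromBlocks_diagonal, Pi.zero_def, diagonal_zero, Pi.one_def,
      diagonal_one]
  rw [hdiag]
  exact PosSemidef.diagonal (Sum.forall.2 ⟨fun _ => le_rfl, fun _ => zero_le_one⟩)

theorem dissipationMatrix_mul_self [Fintype ι] :
    dissipationMatrix ι * dissipationMatrix ι = dissipationMatrix ι := by
  simp [dissipationMatrix, fromBlocks_multiply]

variable [DecidableEq ι]

/-- The skew part of the symmetrised symbol: modes oscillating with frequencies `μ`, coupled to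
the temperature by `β`. -/
def skewMatrix (μ β : ι → ℝ) : Matrix (ι ⊕ Unit) (ι ⊕ Unit) ℂ :=
  fromBlocks (diagonal fun k => Complex.I * μ k) (of fun k _ => -(β k : ℂ))
    (of fun _ k => (β k : ℂ)) 0

theorem conjTranspose_skewMatrix (μ β : ι → ℝ) : (skewMatrix μ β)ᴴ = -skewMatrix μ β := by
  simp only [skewMatrix, fromBlocks_conjTranspose, diagonal_conjTranspose, fromBlocks_neg,
    diagonal_neg, conjTranspose_zero, neg_zero]
  congr 2 <;> ext <;> simp

theorem continuous_skewMatrix :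
    Continuous fun μβ : (ι → ℝ) × (ι → ℝ) => skewMatrix μβ.1 μβ.2 := by
  refine continuous_matrix ?_
  rintro (i | i) (j | j) <;>
    simp only [skewMatrix, fromBlocks_apply₁₁, fromBlocks_apply₁₂, fromBlocks_apply₂₁,
      fromBlocks_apply₂₂, diagonal_apply, of_apply, Matrix.zero_apply]
  · split_ifs <;> fun_prop
  all_goals fun_prop

variable [Fintype ι]

/-- The eigenvectors of the skew part without temperature component are single modes, and these
are excluded by the coupling. -/
theorem eq_zero_of_skewMatrix_mulVec_eq_smul {μ β : ι → ℝ} (hμ : Function.Injective μ)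
    (hβ : ∀ k, β k ≠ 0) {z : ℂ} {v : ι ⊕ Unit → ℂ} (hv : skewMatrix μ β *ᵥ v = z • v)
    (hPv : dissipationMatrix ι *ᵥ v = 0) : v = 0 := by
  have htemp : v (Sum.inr ()) = 0 := by
    simpa [dissipationMatrix, mulVec, dotProduct] using congrFun hPv (Sum.inr ())
  have hmode : ∀ k, Complex.I * μ k * v (Sum.inl k) = z * v (Sum.inl k) := fun k => by
    simpa [skewMatrix, mulVec, dotProduct, htemp, diagonal_apply] using congrFun hv (Sum.inl k)
  have hsum : ∑ k, β k * v (Sum.inl k) = 0 := by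
    simpa [skewMatrix, mulVec, dotProduct, htemp] using congrFun hv (Sum.inr ())
  have hzero : ∀ k, v (Sum.inl k) = 0 := by
    intro k
    by_contra hk
    have hz : Complex.I * μ k = z := mul_right_cancel₀ hk (hmode k)
    have hother : ∀ l, l ≠ k → v (Sum.inl l) = 0 := by
      intro l hlk
      by_contra hl
      have hμz := (mul_right_cancel₀ hl (hmode l)).trans hz.symm
      exact hlk (hμ (Complex.ofReal_injective (mul_left_cancel₀ Complex.I_ne_zero hμz)))
    rw [Finset.sum_eq_single k (fun l _ hl => by rw [hother l hl, mul_zero]) (by simp)] at hsum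
    exact (mul_ne_zero (Complex.ofReal_ne_zero.2 (hβ k)) hk) hsum
  ext (k | _)
  · exact hzero k
  · exact htemp

theorem inner_skewMatrix_apply (μ β : ι → ℝ) (v w : EuclideanSpace ℂ (ι ⊕ Unit)) :
    inner ℂ (toEuclideanCLM (𝕜 := ℂ) (skewMatrix μ β) v) w =
      -inner ℂ v (toEuclideanCLM (𝕜 := ℂ) (skewMatrix μ β) w) := by
  rw [← ContinuousLinearMap.adjoint_inner_right, ← ContinuousLinearMap.star_eq_adjoint, ← map_star,
    star_eq_conjTranspose, conjTranspose_skewMatrix, map_neg, _root_.neg_apply, inner_neg_right]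

theorem re_inner_dissipationMatrix_apply (w : EuclideanSpace ℂ (ι ⊕ Unit)) :
    (inner ℂ w (toEuclideanCLM (𝕜 := ℂ) (dissipationMatrix ι) w)).re =
      ‖toEuclideanCLM (𝕜 := ℂ) (dissipationMatrix ι) w‖ ^ 2 := by
  rw [← inner_self_eq_norm_sq (𝕜 := ℂ), ← ContinuousLinearMap.adjoint_inner_right,
    ← ContinuousLinearMap.star_eq_adjoint, ← map_star, star_eq_conjTranspose,
    posSemidef_dissipationMatrix.isHermitian.eq, ← ContinuousLinearMap.comp_apply,
    ← ContinuousLinearMap.mul_def, ← map_mul, dissipationMatrix_mul_self]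
  rfl

theorem exists_forall_isCompensator_skewMatrix {K : Set ((ι → ℝ) × (ι → ℝ))} (hK : IsCompact K)
    (hμ : ∀ μβ ∈ K, Function.Injective μβ.1) (hβ : ∀ μβ ∈ K, ∀ k, μβ.2 k ≠ 0) :
    ∃ C, 0 < C ∧ ∀ μβ ∈ K, ∃ X, IsCompensator
      (toEuclideanCLM (𝕜 := ℂ) (skewMatrix μβ.1 μβ.2))
      (toEuclideanCLM (𝕜 := ℂ) (dissipationMatrix ι)) X C := by
  set T := toEuclideanCLM (n := ι ⊕ Unit) (𝕜 := ℂ)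
  have hT : Continuous T :=
    T.toAlgEquiv.toLinearMap.continuous_of_finiteDimensional
  obtain ⟨C, hC, h⟩ := exists_forall_isCompensator (P := T (dissipationMatrix ι))
    (fun w => by rw [re_inner_dissipationMatrix_apply]; positivity)
    (hK.image (hT.comp continuous_skewMatrix)) (by
      rintro _ ⟨μβ, hμβ, rfl⟩
      exact exists_isCompensator (conjTranspose_skewMatrix _ _) posSemidef_dissipationMatrix
        fun z v => eq_zero_of_skewMatrix_mulVec_eq_smul (hμ μβ hμβ) (hβ μβ hμβ))
  exact ⟨C, hC, fun μβ hμβ => h _ (Set.mem_image_of_mem _ hμβ)⟩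

end Symmetrization

end ThermoElastic

namespace ThermoElastic

open Matrix

section Eigenvalues

variable {n : ℕ} [Fact (3 ≤ n)] (A : ElasticSymbol n)

theorem exists_eigenvalue_eq (η : Sph n) : ∃ e : Fin n ≃ Fin n, ∀ j,
    eigenvalue A j η = (A.posDef η).isHermitian.eigenvalues (e j) := by
  let e : Fin (Fintype.card (Fin n)) ≃ Fin n := Fintype.equivOfCardEq (Fintype.card_fin _)
  refine ⟨(Fin.revPerm.trans (finCongr (Fintype.card_fin n).symm)).trans e, fun j => ?_⟩
  simp [eigenvalue, IsHermitian.eigenvalues, e]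

theorem eigenvalue_pos (j : Fin n) (η : Sph n) : 0 < eigenvalue A j η := by
  obtain ⟨e, he⟩ := exists_eigenvalue_eq A η
  rw [he]
  exact (A.posDef η).eigenvalues_pos _

variable {A}

theorem IsNondegenerate.injective_eigenvalue {η : Sph n} (h : IsNondegenerate A η) :
    Function.Injective fun j => eigenvalue A j η := by
  obtain ⟨e, he⟩ := exists_eigenvalue_eq A η
  rw [IsNondegenerate, (A.posDef η).isHermitian.spectrum_real_eq_range_eigenvalues,
    ← Set.image_univ] at h
  have hinj : Function.Injective (A.posDef η).isHermitian.eigenvalues := by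
    rw [← Set.injOn_univ, ← Set.ncard_image_iff, h, Set.ncard_univ, Nat.card_fin]
  intro i j hij
  simp only [he] at hij
  exact e.injective (hinj hij)

theorem IsParabolic.ne_zero {r : Fin n → Sph n → Space n} {η : Sph n} (h : IsParabolic A r η)
    (j : Fin n) : r j η ≠ 0 := fun h₀ =>
  h.2 j (by rw [h₀, inner_zero_left])

theorem continuousOn_eigenvalue {K : Set (Sph n)} {j : Fin n} {r : Sph n → Space n}
    (hr : ContinuousOn r K) (hr₀ : ∀ η ∈ K, r η ≠ 0)
    (heigen : ∀ η ∈ K, toEuclideanLin (A.toFun η) (r η) = eigenvalue A j η • r η) :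
    ContinuousOn (eigenvalue A j) K := by
  have hrayleigh : ∀ η ∈ K, eigenvalue A j η =
      inner ℝ (r η) (toEuclideanLin (A.toFun η) (r η)) / ‖r η‖ ^ 2 := fun η hη => by
    rw [heigen η hη, inner_smul_right, real_inner_self_eq_norm_sq,
      mul_div_cancel_right₀ _ (pow_ne_zero 2 (norm_ne_zero_iff.2 (hr₀ η hη)))]
  have hA : Continuous A.toFun := continuous_matrix fun i k => (A.analytic i k).continuous
  have hAr : ContinuousOn (fun η => toEuclideanLin (A.toFun η) (r η)) K :=
    (PiLp.continuous_toLp 2 _).comp_continuousOn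
      ((continuous_fst.matrix_mulVec continuous_snd).comp_continuousOn
        (hA.continuousOn.prodMk ((PiLp.continuous_ofLp 2 _).comp_continuousOn hr)))
  exact ((hr.inner hAr).div (hr.norm.pow 2)
    fun η hη => pow_ne_zero 2 (norm_ne_zero_iff.2 (hr₀ η hη))).congr hrayleigh

end Eigenvalues

section Modes

variable {n : ℕ}

/-- The direction-dependent couplings `rⱼ(η) · η` of the `2n` elastic modes to the temperature. -/
def modeCoupling (r : Fin n → Sph n → Space n) (η : Sph n) (k : Fin n ⊕ Fin n) : ℝ :=
  inner ℝ (r (Sum.elim id id k) η) (η : Space n)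

theorem coupling_eq_norm_mul_modeCoupling (r : Fin n → Sph n → Space n) (ξ : Space n)
    (hξ : ξ ≠ 0) (k : Fin n ⊕ Fin n) :
    coupling r (Sum.elim id id k) ξ hξ = ‖ξ‖ * modeCoupling r (direction ξ hξ) k := by
  have hpolar : ξ = ‖ξ‖ • (direction ξ hξ : Space n) := by
    rw [direction, smul_smul, mul_inv_cancel₀ (norm_ne_zero_iff.2 hξ), one_smul]
  rw [coupling, modeCoupling, ← inner_smul_right, ← hpolar]

/-- Scales the temperature by `√2`, which makes the coupling terms of `i B(ξ)` skew. -/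
def symmetrizer (n : ℕ) : Matrix (Idx n) (Idx n) ℂ :=
  diagonal (Sum.elim (fun _ => 1) fun _ => (√2 : ℂ))

theorem norm_sq_symmetrizer_apply (w : State n) :
    ‖toEuclideanCLM (𝕜 := ℂ) (symmetrizer n) w‖ ^ 2 = ‖w‖ ^ 2 + ‖w (Sum.inr ())‖ ^ 2 := by
  have hnorm : ‖(√2 : ℂ)‖ ^ 2 = 2 := by
    rw [Complex.norm_real, Real.norm_of_nonneg (by positivity), Real.sq_sqrt zero_le_two]
  simp only [EuclideanSpace.norm_sq_eq, ofLp_toEuclideanCLM, symmetrizer, mulVec_diagonal,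
    norm_mul, mul_pow, Fintype.sum_sum_type, Sum.elim_inl, Sum.elim_inr, norm_one, one_pow, one_mul,
    Finset.univ_unique, Finset.sum_singleton, hnorm]
  ring

theorem norm_sq_le_norm_sq_symmetrizer_apply (w : State n) :
    ‖w‖ ^ 2 ≤ ‖toEuclideanCLM (𝕜 := ℂ) (symmetrizer n) w‖ ^ 2 := by
  rw [norm_sq_symmetrizer_apply]
  exact le_add_of_nonneg_right (sq_nonneg _)

theorem norm_sq_symmetrizer_apply_le (w : State n) :
    ‖toEuclideanCLM (𝕜 := ℂ) (symmetrizer n) w‖ ^ 2 ≤ 2 * ‖w‖ ^ 2 := by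
  rw [norm_sq_symmetrizer_apply, two_mul]
  gcongr
  exact PiLp.norm_apply_le w _

variable [Fact (3 ≤ n)] (A : ElasticSymbol n)

/-- The frequencies `±√ϰⱼ(η)` of the `2n` elastic modes. -/
def modeFreq (η : Sph n) : Fin n ⊕ Fin n → ℝ :=
  Sum.elim (fun j => √(eigenvalue A j η)) (fun j => -√(eigenvalue A j η))

variable {A}

theorem IsNondegenerate.injective_modeFreq {η : Sph n} (h : IsNondegenerate A η) :
    Function.Injective (modeFreq A η) := by
  have hpos : ∀ j, 0 < √(eigenvalue A j η) := fun j => Real.sqrt_pos.2 (eigenvalue_pos A j η)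
  have hinj : Function.Injective fun j => √(eigenvalue A j η) := fun i j hij =>
    h.injective_eigenvalue
      ((Real.sqrt_inj (eigenvalue_pos A i η).le (eigenvalue_pos A j η).le).1 hij)
  exact hinj.sumElim (neg_injective.comp hinj) fun i j => by linarith [hpos i, hpos j]

theorem continuousOn_modeFreq {r : Fin n → Sph n → Space n} {K : Set (Sph n)}
    (hr : ∀ j, ContinuousOn (r j) K) (hpar : ∀ η ∈ K, IsParabolic A r η)
    (heigen : ∀ j, ∀ η ∈ K, toEuclideanLin (A.toFun η) (r j η) = eigenvalue A j η • r j η) :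
    ContinuousOn (modeFreq A) K := by
  have hsqrt : ∀ j, ContinuousOn (fun η => √(eigenvalue A j η)) K := fun j =>
    (continuousOn_eigenvalue (hr j) (fun η hη => (hpar η hη).ne_zero j) (heigen j)).sqrt
  refine continuousOn_pi.2 ?_
  rintro (j | j)
  · exact hsqrt j
  · exact (hsqrt j).neg

theorem symmetrizer_mul_symbolB (κ γ : ℝ) (r : Fin n → Sph n → Space n) (ξ : Space n)
    (hξ : ξ ≠ 0) :
    symmetrizer n * (Complex.I • symbolB A κ γ r ξ hξ) =
      ((‖ξ‖ : ℂ) • skewMatrix (modeFreq A (direction ξ hξ))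
          ((γ / √2) • modeCoupling r (direction ξ hξ)) -
        ((κ * ‖ξ‖ ^ 2 : ℝ) : ℂ) • dissipationMatrix (Fin n ⊕ Fin n)) * symmetrizer n := by
  have hsqrt : (√2 : ℂ) * √2 = 2 := by
    exact_mod_cast Real.mul_self_sqrt (zero_le_two (α := ℝ))
  have hdiv : (γ : ℂ) / √2 = γ / 2 * √2 := by
    rw [div_eq_iff fun h₀ => by simp [h₀] at hsqrt]
    linear_combination -(γ / 2 : ℂ) * hsqrt
  have hI := Complex.I_mul_I
  ext i j
  rw [symmetrizer, diagonal_mul, mul_diagonal]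
  rcases i with (i | i) | i <;> rcases j with (j | j) | j <;>
    simp only [symbolB, skewMatrix, dissipationMatrix, coupling_eq_norm_mul_modeCoupling, omega,
      modeFreq, fromBlocks_diagonal, fromBlocks_apply₁₁, fromBlocks_apply₁₂, fromBlocks_apply₂₁,
      fromBlocks_apply₂₂, diagonal_apply, one_apply_eq, of_apply, Sum.elim_inl, Sum.elim_inr,
      Sum.inl.injEq, Sum.inr.injEq, reduceCtorEq, if_false, Matrix.smul_apply, Matrix.sub_apply,
      Matrix.zero_apply, Pi.smul_apply, smul_eq_mul, Complex.coe_smul, Complex.real_smul,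
      Complex.ofReal_mul, Complex.ofReal_pow, Complex.ofReal_neg, Complex.ofReal_div, hdiv]
  case inr.inr => linear_combination (κ * ‖ξ‖ ^ 2 * √2 : ℂ) * hI
  all_goals grind

theorem hasDerivWithinAt_symmetrizer_apply {κ γ : ℝ} {r : Fin n → Sph n → Space n}
    {ξ : Space n} {hξ : ξ ≠ 0} {w : ℝ → State n} {s : Set ℝ} {t : ℝ}
    (hw : HasDerivWithinAt w
      (Complex.I • toEuclideanLin (symbolB A κ γ r ξ hξ) (w t)) s t) :
    HasDerivWithinAt (fun τ => toEuclideanCLM (𝕜 := ℂ) (symmetrizer n) (w τ))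
      (dampedGenerator
        (toEuclideanCLM (𝕜 := ℂ) (skewMatrix (modeFreq A (direction ξ hξ))
          ((γ / √2) • modeCoupling r (direction ξ hξ))))
        (toEuclideanCLM (𝕜 := ℂ) (dissipationMatrix (Fin n ⊕ Fin n))) κ ‖ξ‖
        (toEuclideanCLM (𝕜 := ℂ) (symmetrizer n) (w t))) s t := by
  set T := toEuclideanCLM (n := Idx n) (𝕜 := ℂ)
  have hconj := congrArg T (symmetrizer_mul_symbolB (A := A) κ γ r ξ hξ)
  simp only [map_mul, map_sub, map_smul] at hconj
  have hderiv := ((T (symmetrizer n)).restrictScalars ℝ).hasFDerivAt.comp_hasDerivWithinAt t hw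
  exact hderiv.congr_deriv (DFunLike.congr_fun hconj (w t))

/-- The parameters of the skew part range over a compact set, which gives a common compensator
constant and hence a common rate. -/
theorem exists_flow_decay {κ γ : ℝ} (hκ : 0 < κ) (hγ : γ ≠ 0) {K : Set (Sph n)}
    (hK : IsCompact K) {r : Fin n → Sph n → Space n} (hr : ∀ j, ContinuousOn (r j) K)
    (heigen : ∀ j, ∀ η ∈ K, toEuclideanLin (A.toFun η) (r j η) = eigenvalue A j η • r j η)
    (hpar : ∀ η ∈ K, IsParabolic A r η) :
    ∃ c, 0 < c ∧ ∀ (ξ : Space n) (hξ : ξ ≠ 0), direction ξ hξ ∈ K → ∀ w : ℝ → State n,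
      (∀ t, 0 ≤ t → HasDerivWithinAt w
        (Complex.I • toEuclideanLin (symbolB A κ γ r ξ hξ) (w t)) (Set.Ici 0) t) →
      ∀ t, 0 ≤ t → ‖w t‖ ≤ 3 * Real.exp (-(c * min 1 (‖ξ‖ ^ 2)) * t) * ‖w 0‖ := by
  have hparam : ContinuousOn (fun η => (modeFreq A η, (γ / √2) • modeCoupling r η)) K :=
    (continuousOn_modeFreq hr hpar heigen).prodMk <| continuousOn_pi.2 fun k =>
      (((hr _).inner continuous_subtype_val.continuousOn).const_smul (γ / √2))
  obtain ⟨C, hC, hcomp⟩ := exists_forall_isCompensator_skewMatrix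
    (hK.image_of_continuousOn hparam)
    (Set.forall_mem_image.2 fun η hη => (hpar η hη).1.injective_modeFreq)
    (Set.forall_mem_image.2 fun η hη k =>
      smul_ne_zero (div_ne_zero hγ (by positivity)) ((hpar η hη).2 _))
  have hb := relaxationRate_pos hC hκ
  refine ⟨relaxationRate C κ / 6, by positivity, fun ξ hξ hdir w hw t ht => ?_⟩
  obtain ⟨X, hX⟩ := hcomp _ (Set.mem_image_of_mem _ hdir)
  have hflow := hX.norm_sq_flow_le (inner_skewMatrix_apply _ _)
    (fun w => (re_inner_dissipationMatrix_apply w).ge) hC hκ (norm_pos_iff.2 hξ)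
    (fun t ht => hasDerivWithinAt_symmetrizer_apply (hw t ht)) ht
  set e := Real.exp (-(relaxationRate C κ / 6 * min 1 (‖ξ‖ ^ 2)) * t) with he
  have hexp : Real.exp (-(relaxationRate C κ / 3 * min 1 (‖ξ‖ ^ 2)) * t) = e ^ 2 := by
    rw [he, ← Real.exp_nat_mul]
    congr 1
    push_cast
    ring
  refine le_of_sq_le_sq ?_ (by positivity)
  calc ‖w t‖ ^ 2 ≤ 3 * (2 * ‖w 0‖ ^ 2) * e ^ 2 := by
        rw [hexp] at hflow
        refine (norm_sq_le_norm_sq_symmetrizer_apply _).trans (hflow.trans ?_)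
        gcongr
        exact norm_sq_symmetrizer_apply_le _
    _ ≤ (3 * e * ‖w 0‖) ^ 2 := by nlinarith [sq_nonneg (e * ‖w 0‖)]

end Modes

end ThermoElastic

section RealFunctions

theorem exists_norm_le_of_eventually_const {F : Type*} [SeminormedAddCommGroup F] {f : ℝ → F}
    (hf : Continuous f) {a b : ℝ} {u v : F} (hu : ∀ s ≤ a, f s = u) (hv : ∀ s, b ≤ s → f s = v) :
    ∃ B, ∀ s, ‖f s‖ ≤ B := by
  obtain ⟨B, hB⟩ := (isCompact_Icc (a := a) (b := b)).exists_bound_of_continuousOn hf.continuousOn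
  refine ⟨max B (max ‖u‖ ‖v‖), fun s => ?_⟩
  rcases le_total s a with ha | ha
  · simp [hu s ha]
  rcases le_total b s with hb | hb
  · simp [hv s hb]
  · exact (hB s ⟨ha, hb⟩).trans (le_max_left _ _)

theorem exp_neg_min_one_sq_mul_le {c R x t : ℝ} (hc : 0 ≤ c) (hR : 0 < R) (hx : 0 ≤ x)
    (hxR : x ≤ R) (ht : 0 ≤ t) :
    Real.exp (-(c * min 1 (x ^ 2)) * t) ≤
      Real.exp c * Real.exp (-(c * min 1 (1 / R ^ 2) * (1 + t)) * x ^ 2) := by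
  set m := min 1 (1 / R ^ 2)
  have hmx : m * x ^ 2 ≤ min 1 (x ^ 2) := by
    refine le_min ?_ (mul_le_of_le_one_left (sq_nonneg x) (min_le_left _ _))
    calc m * x ^ 2 ≤ 1 / R ^ 2 * R ^ 2 := by gcongr; exact min_le_right _ _
      _ = 1 := by field_simp
  rw [← Real.exp_add, Real.exp_le_exp]
  have hmain : c * (m * x ^ 2) * t ≤ c * min 1 (x ^ 2) * t := by gcongr
  have hextra : c * (m * x ^ 2) ≤ c :=
    mul_le_of_le_one_right hc (hmx.trans (min_le_left _ _))
  linear_combination hmain + hextra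

end RealFunctions

namespace ThermoElastic

section HomogeneousExtension

variable {n : ℕ} {ψ : Sph n → ℂ}

theorem continuousOn_homExt (hψ : Continuous ψ) : ContinuousOn (homExt ψ) {0}ᶜ := by
  rw [continuousOn_iff_continuous_domRestrict]
  have heq : Set.domRestrict {0}ᶜ (homExt ψ) = fun ξ : ({0}ᶜ : Set (Space n)) =>
      ψ (direction ξ.1 ξ.2) := funext fun ξ => dif_pos ξ.2
  rw [heq]
  refine hψ.comp (Continuous.subtype_mk ?_ _)
  exact (continuous_subtype_val.norm.inv₀ fun ξ => norm_ne_zero_iff.2 ξ.2).smul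
    continuous_subtype_val

theorem measurable_homExt (hψ : Continuous ψ) : Measurable (homExt ψ) :=
  measurable_of_continuousOn_compl_singleton 0 (continuousOn_homExt hψ)

theorem exists_norm_homExt_le (hψ : Continuous ψ) : ∃ B, ∀ ξ, ‖homExt ψ ξ‖ ≤ B := by
  obtain ⟨B, hB⟩ := isCompact_univ.exists_bound_of_continuousOn hψ.continuousOn
  refine ⟨max B 0, fun ξ => ?_⟩
  rw [homExt]
  split_ifs
  · exact (hB _ (Set.mem_univ _)).trans (le_max_left _ _)
  · exact norm_zero.trans_le (le_max_right _ _)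

theorem exists_direction_mem_of_homExt_ne_zero {ξ : Space n} (h : homExt ψ ξ ≠ 0) :
    ∃ hξ : ξ ≠ 0, direction ξ hξ ∈ tsupport ψ := by
  rw [homExt] at h
  split_ifs at h with hξ
  · exact ⟨hξ, subset_tsupport _ h⟩
  · exact absurd rfl h

end HomogeneousExtension

section Multipliers

variable {n : ℕ}

theorem exists_eLpNorm_multiplier_le {p q : ℝ≥0∞} (hp : 1 ≤ p) (hp₂ : p ≤ 2) (hq : 2 ≤ q) :
    ∃ C, 0 < C ∧ ∀ (m : Space n → ℂ) (B : ℝ) (f g : L2 n) (w : Space n → ℝ),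
      Measurable m → (∀ ξ, ‖m ξ‖ ≤ B) → AEStronglyMeasurable w volume →
      (∀ᵐ k, ‖m ((2 * Real.pi) • k)‖ * ‖(𝓕 f : L2 n) k‖ ≤ w k * ‖(𝓕 g : L2 n) k‖) →
      eLpNorm (multiplier m f) q volume ≤
        ENNReal.ofReal C * eLpNorm w (p⁻¹ - q⁻¹)⁻¹ volume * eLpNorm g p volume := by
  obtain ⟨C, hC, hbound⟩ :=
    exists_eLpNorm_fourierInv_le (E := Space n) (F := State n) hp hp₂ hq
  refine ⟨C, hC, fun m B f g w hm hB hw hle => ?_⟩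
  rw [← FourierTransform.fourierInv_fourier_eq (F := L2 n) (multiplier m f)]
  refine hbound g _ w hw ?_
  filter_upwards [fourier_multiplier hm hB f, hle] with k hk hlek
  rwa [hk, norm_smul]

theorem norm_fourier_bessel_apply (s : ℝ) (f : 𝓢(Space n, State n)) (k : Space n) :
    ‖(𝓕 (SchwartzMap.fourierMultiplierCLM (State n)
      (fun k : Space n => (((1 + ‖(2 * Real.pi) • k‖ ^ 2) ^ (s / 2) : ℝ) : ℂ)) f) :
        𝓢(Space n, State n)) k‖ =
      (1 + ‖(2 * Real.pi) • k‖ ^ 2) ^ (s / 2) * ‖(𝓕 f : 𝓢(Space n, State n)) k‖ := by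
  have hreal : (fun k : Space n =>
      (1 + ‖(2 * Real.pi) • k‖ ^ 2) ^ (s / 2)).HasTemperateGrowth :=
    (Function.hasTemperateGrowth_one_add_norm_sq_rpow (Space n) (s / 2)).comp
      ((2 * Real.pi) • ContinuousLinearMap.id ℝ (Space n)).hasTemperateGrowth
  have hcomplex : (fun k : Space n =>
      (((1 + ‖(2 * Real.pi) • k‖ ^ 2) ^ (s / 2) : ℝ) : ℂ)).HasTemperateGrowth :=
    Function.HasTemperateGrowth.comp Function.Complex.hasTemperateGrowth_ofReal hreal
  rw [SchwartzMap.fourierMultiplierCLM_apply, FourierTransform.fourier_fourierInv_eq,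
    SchwartzMap.smulLeftCLM_apply_apply hcomplex, norm_smul (β := State n), Complex.norm_real,
    Real.norm_of_nonneg (by positivity)]

end Multipliers

section SolutionDecay

variable {n : ℕ} [Fact (3 ≤ n)]

/-- The pointwise estimate `|V̂(t,ξ)| ≤ 3 exp(-c min(1,|ξ|²) t) |V̂₀(ξ)|` for all solutions, over
the directions in the support of `ψ`; the frequency is `ξ = 2πk`. -/
def HasSolutionDecay (A : ElasticSymbol n) (κ γ : ℝ) (r : Fin n → Sph n → Space n)
    (ψ ψ' : Sph n → ℂ) (c : ℝ) : Prop :=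
  ∀ (V₀ : 𝓢(Space n, State n)) (V : ℝ → L2 n), IsSolution A κ γ r ψ' V₀ V → ∀ t, 0 ≤ t →
    ∀ᵐ k : Space n, ∀ h : (2 * Real.pi) • k ≠ 0, direction ((2 * Real.pi) • k) h ∈ tsupport ψ →
      ‖(𝓕 (V t) : L2 n) k‖ ≤ 3 * Real.exp (-(c * min 1 (‖(2 * Real.pi) • k‖ ^ 2)) * t) *
        ‖(𝓕 V₀ : 𝓢(Space n, State n)) k‖

variable {A : ElasticSymbol n} {κ γ : ℝ} {r : Fin n → Sph n → Space n} {ψ ψ' : Sph n → ℂ}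

theorem exists_hasSolutionDecay (hκ : 0 < κ) (hγ : γ ≠ 0)
    (hr : ∀ j, ContinuousOn (r j) (tsupport ψ))
    (heigen : ∀ j, ∀ η ∈ tsupport ψ,
      Matrix.toEuclideanLin (A.toFun η) (r j η) = eigenvalue A j η • r j η)
    (hpar : ∀ η ∈ tsupport ψ, IsParabolic A r η) (hψ' : Continuous ψ')
    (hone : ∀ η ∈ tsupport ψ, ψ' η = 1) :
    ∃ c, 0 < c ∧ HasSolutionDecay A κ γ r ψ ψ' c := by
  obtain ⟨c, hc, hflow⟩ :=
    exists_flow_decay hκ hγ (isClosed_tsupport ψ).isCompact hr heigen hpar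
  refine ⟨c, hc, fun V₀ V ⟨hV₀, W, hW, _, hode⟩ t ht => ?_⟩
  have h2π : 2 * Real.pi ≠ 0 := by positivity
  have hscale := Measure.quasiMeasurePreserving_smul (volume : Measure (Space n)) h2π
  obtain ⟨B, hB⟩ := exists_norm_homExt_le hψ'
  have hinit := fourier_multiplier (measurable_homExt hψ') hB (V₀.toLp 2 : L2 n)
  rw [← hV₀, SchwartzMap.toLp_fourier_eq] at hinit
  filter_upwards [hscale.ae (hW t ht), hscale.ae (hW 0 le_rfl), hscale.ae hode, hinit,
    (𝓕 V₀ : 𝓢(Space n, State n)).coeFn_toLp 2 (volume : Measure (Space n))]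
    with k hWt hW0 hodek hinitk hV₀k hk hdir
  have hmem : direction ((2 * Real.pi) • k) hk ∈ tsupport ψ' :=
    subset_tsupport _ (by simp [hone _ hdir])
  have hdecay := hflow _ hk hdir (fun s => W s ((2 * Real.pi) • k)) (hodek hk hmem) t ht
  simp only [hWt, hW0, inv_smul_smul₀ h2π] at hdecay
  rwa [hinitk, hV₀k, homExt, dif_pos hk, hone _ hdir, one_smul] at hdecay

variable {c : ℝ} {φ : ℝ → ℂ} {p q : ℝ≥0∞}

theorem HasSolutionDecay.exists_eLpNorm_multiplier_le (hdec : HasSolutionDecay A κ γ r ψ ψ' c)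
    (hψ : Continuous ψ) (hφ : Continuous φ) (hφ_bdd : ∃ B, ∀ s, ‖φ s‖ ≤ B)
    (hp : 1 ≤ p) (hp₂ : p ≤ 2) (hq : 2 ≤ q) :
    ∃ C, 0 ≤ C ∧ ∀ V₀ V, IsSolution A κ γ r ψ' V₀ V → ∀ t, 0 ≤ t →
      ∀ (f : 𝓢(Space n, State n)) (w : Space n → ℝ), AEStronglyMeasurable w volume →
      (∀ k, 0 ≤ w k) →
      (∀ k, φ ‖(2 * Real.pi) • k‖ ≠ 0 →
        Real.exp (-(c * min 1 (‖(2 * Real.pi) • k‖ ^ 2)) * t) *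
          ‖(𝓕 V₀ : 𝓢(Space n, State n)) k‖ ≤ w k * ‖(𝓕 f : 𝓢(Space n, State n)) k‖) →
      eLpNorm (multiplier (fun ξ => φ ‖ξ‖ * homExt ψ ξ) (V t)) q volume ≤
        ENNReal.ofReal C * eLpNorm w (p⁻¹ - q⁻¹)⁻¹ volume * eLpNorm f p volume := by
  obtain ⟨C, hC, hmult⟩ := ThermoElastic.exists_eLpNorm_multiplier_le (n := n) hp hp₂ hq
  obtain ⟨Bψ, hBψ⟩ := exists_norm_homExt_le hψ
  obtain ⟨Bφ, hBφ⟩ := hφ_bdd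
  have hBψ₀ : 0 ≤ Bψ := (norm_nonneg _).trans (hBψ 0)
  have hBφ₀ : 0 ≤ Bφ := (norm_nonneg _).trans (hBφ 0)
  set D := 3 * (Bφ * Bψ) with hD
  refine ⟨C * D, by positivity, fun V₀ V hV t ht f w hw hw₀ hle => ?_⟩
  have hbound : ∀ ξ : Space n, ‖φ ‖ξ‖ * homExt ψ ξ‖ ≤ Bφ * Bψ := fun ξ =>
    (norm_mul_le _ _).trans (mul_le_mul (hBφ _) (hBψ ξ) (norm_nonneg _) hBφ₀)
  have hpointwise : ∀ᵐ k, ‖φ ‖(2 * Real.pi) • k‖ * homExt ψ ((2 * Real.pi) • k)‖ *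
      ‖(𝓕 (V t) : L2 n) k‖ ≤ (D • w) k * ‖(𝓕 (f.toLp 2) : L2 n) k‖ := by
    rw [SchwartzMap.toLp_fourier_eq]
    filter_upwards [hdec V₀ V hV t ht,
      (𝓕 f : 𝓢(Space n, State n)).coeFn_toLp 2 (volume : Measure (Space n))] with k hVk hfk
    rw [hfk, Pi.smul_apply, smul_eq_mul]
    rcases eq_or_ne (φ ‖(2 * Real.pi) • k‖ * homExt ψ ((2 * Real.pi) • k)) 0 with h₀ | h₀
    · rw [h₀, norm_zero, zero_mul]
      exact mul_nonneg (mul_nonneg (by positivity) (hw₀ k)) (norm_nonneg _)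
    obtain ⟨hk, hdir⟩ := exists_direction_mem_of_homExt_ne_zero (right_ne_zero_of_mul h₀)
    have hVk' := (hVk hk hdir).trans_eq (mul_assoc _ _ _)
    calc _ ≤ Bφ * Bψ * (3 * (w k * ‖(𝓕 f : 𝓢(Space n, State n)) k‖)) :=
          mul_le_mul (hbound _) (hVk'.trans (mul_le_mul_of_nonneg_left
            (hle k (left_ne_zero_of_mul h₀)) zero_le_three)) (norm_nonneg _) (by positivity)
      _ = _ := by rw [hD]; ring
  refine (hmult _ _ _ _ (D • w) ((hφ.measurable.comp measurable_norm).mul (measurable_homExt hψ))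
    hbound (hw.const_smul D) hpointwise).trans_eq ?_
  rw [eLpNorm_const_smul, eLpNorm_congr_ae (f.coeFn_toLp 2 (volume : Measure (Space n))),
    Real.enorm_of_nonneg (by positivity), ENNReal.ofReal_mul hC.le, ← mul_assoc]

theorem HasSolutionDecay.exists_high_frequency_le (hdec : HasSolutionDecay A κ γ r ψ ψ' c)
    (hc : 0 ≤ c) (hψ : Continuous ψ) (hφ : Continuous φ) (hφ_bdd : ∃ B, ∀ s, ‖φ s‖ ≤ B)
    {ε : ℝ} (hε : 0 ≤ ε) (hφ_zero : ∀ s ≤ ε, φ s = 0)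
    (hp : 1 ≤ p) (hp₂ : p ≤ 2) (hq : 2 ≤ q) {s : ℝ} (hs : n * (p⁻¹ - q⁻¹).toReal < s) :
    ∃ K, 0 < K ∧ ∀ V₀ V, IsSolution A κ γ r ψ' V₀ V → ∀ t, 0 ≤ t →
      eLpNorm (multiplier (fun ξ => φ ‖ξ‖ * homExt ψ ξ) (V t)) q volume ≤
        ENNReal.ofReal (K * Real.exp (-(c * min 1 (ε ^ 2)) * t)) * sobolevNorm p s V₀ := by
  obtain ⟨C, hC, hweighted⟩ := hdec.exists_eLpNorm_multiplier_le hψ hφ hφ_bdd hp hp₂ hq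
  set b : Space n → ℝ := fun k => (1 + ‖(2 * Real.pi) • k‖ ^ 2) ^ (-(s / 2)) with hb
  have hbLp : MemLp b (p⁻¹ - q⁻¹)⁻¹ volume :=
    memLp_one_add_norm_smul_sq_rpow (by positivity) (by rwa [finrank_euclideanSpace_fin])
  set L := (eLpNorm b (p⁻¹ - q⁻¹)⁻¹ volume).toReal with hL
  have hL₀ : 0 ≤ L := ENNReal.toReal_nonneg
  refine ⟨C * L + 1, by positivity, fun V₀ V hV t ht => ?_⟩
  set e := Real.exp (-(c * min 1 (ε ^ 2)) * t) with he
  have he₀ : 0 < e := Real.exp_pos _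
  have hcancel : ∀ k : Space n, b k * (1 + ‖(2 * Real.pi) • k‖ ^ 2) ^ (s / 2) = 1 := fun k => by
    rw [hb, ← Real.rpow_add (by positivity), neg_add_cancel, Real.rpow_zero]
  refine (hweighted V₀ V hV t ht (SchwartzMap.fourierMultiplierCLM (State n)
    (fun k : Space n => (((1 + ‖(2 * Real.pi) • k‖ ^ 2) ^ (s / 2) : ℝ) : ℂ)) V₀) (e • b)
    (hbLp.1.const_smul e) (fun k => by simp only [hb, Pi.smul_apply]; positivity)
    fun k hk => ?_).trans ?_
  · have hεk : ε ≤ ‖(2 * Real.pi) • k‖ := le_of_not_ge fun hle => hk (hφ_zero _ hle)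
    rw [norm_fourier_bessel_apply, Pi.smul_apply, smul_eq_mul, ← mul_assoc, mul_assoc e,
      hcancel, mul_one, he]
    gcongr
  · rw [sobolevNorm, eLpNorm_const_smul, Real.enorm_of_nonneg he₀.le,
      ← ENNReal.ofReal_toReal hbLp.2.ne, ← hL, ← ENNReal.ofReal_mul he₀.le,
      ← ENNReal.ofReal_mul hC, mul_comm e, ← mul_assoc]
    gcongr
    exact le_add_of_nonneg_right zero_le_one

theorem HasSolutionDecay.exists_low_frequency_le (hdec : HasSolutionDecay A κ γ r ψ ψ' c)
    (hc : 0 < c) (hψ : Continuous ψ) (hφ : Continuous φ) (hφ_bdd : ∃ B, ∀ s, ‖φ s‖ ≤ B)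
    {R : ℝ} (hR : 0 < R) (hφ_zero : ∀ s, R ≤ s → φ s = 0)
    (hp : 1 ≤ p) (hp₂ : p ≤ 2) (hq : 2 ≤ q) :
    ∃ K, 0 < K ∧ ∀ V₀ V, IsSolution A κ γ r ψ' V₀ V → ∀ t, 0 ≤ t →
      eLpNorm (multiplier (fun ξ => φ ‖ξ‖ * homExt ψ ξ) (V t)) q volume ≤
        ENNReal.ofReal (K * (1 + t) ^ (-((n : ℝ) / 2) * (p⁻¹ - q⁻¹).toReal)) *
          eLpNorm V₀ p volume := by
  obtain ⟨C, hC, hweighted⟩ := hdec.exists_eLpNorm_multiplier_le hψ hφ hφ_bdd hp hp₂ hq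
  have hρ : p⁻¹ - q⁻¹ ≠ ⊤ :=
    ENNReal.sub_ne_top (ENNReal.inv_ne_top.2 (zero_lt_one.trans_le hp).ne')
  set ρ := p⁻¹ - q⁻¹
  set a := c * min 1 (1 / R ^ 2) * (2 * Real.pi) ^ 2 with ha
  have ha₀ : 0 < a := by positivity
  set G := (Real.pi * ρ.toReal / a) ^ ((n : ℝ) / 2 * ρ.toReal) with hG
  refine ⟨C * Real.exp c * G + 1, by positivity, fun V₀ V hV t ht => ?_⟩
  set g : Space n → ℝ := fun k => Real.exp (-(a * (1 + t)) * ‖k‖ ^ 2) with hg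
  have hgauss : eLpNorm g ρ⁻¹ volume ≤
      ENNReal.ofReal (G * (1 + t) ^ (-((n : ℝ) / 2) * ρ.toReal)) := by
    refine (eLpNorm_exp_neg_mul_norm_sq_le hρ (by positivity)).trans_eq ?_
    rw [finrank_euclideanSpace_fin, ← div_div, Real.div_rpow (by positivity) (by positivity),
      ← hG, neg_mul, Real.rpow_neg (by positivity), div_eq_mul_inv]
  refine (hweighted V₀ V hV t ht V₀ (Real.exp c • g) (by fun_prop)
    (fun k => by simp only [hg, Pi.smul_apply]; positivity) fun k hk => ?_).trans ?_
  · have hkR : ‖(2 * Real.pi) • k‖ ≤ R := le_of_not_ge fun hle => hk (hφ_zero _ hle)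
    have hnorm : ‖(2 * Real.pi) • k‖ ^ 2 = (2 * Real.pi) ^ 2 * ‖k‖ ^ 2 := by
      rw [norm_smul, mul_pow, Real.norm_of_nonneg (by positivity)]
    gcongr
    refine (exp_neg_min_one_sq_mul_le hc.le hR (norm_nonneg _) hkR ht).trans_eq ?_
    rw [Pi.smul_apply, smul_eq_mul, hg, hnorm, ha]
    ring_nf
  · rw [eLpNorm_const_smul, Real.enorm_of_nonneg (Real.exp_pos c).le]
    gcongr
    calc _ ≤ ENNReal.ofReal C * (ENNReal.ofReal (Real.exp c) *
          ENNReal.ofReal (G * (1 + t) ^ (-((n : ℝ) / 2) * ρ.toReal))) := by gcongr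
      _ = ENNReal.ofReal (C * Real.exp c * G * (1 + t) ^ (-((n : ℝ) / 2) * ρ.toReal)) := by
        rw [← ENNReal.ofReal_mul (Real.exp_pos c).le, ← ENNReal.ofReal_mul hC]
        congr 1
        ring
      _ ≤ _ := by
        gcongr
        exact le_add_of_nonneg_right zero_le_one

end SolutionDecay

end ThermoElastic

end

theorem mainTheorem6_general {n : ℕ} [Fact (3 ≤ n)] (A : ThermoElastic.ElasticSymbol n)
    (κ γ : ℝ) (hκ : 0 < κ) (hγ : γ ≠ 0)
    (r : Fin n → ThermoElastic.Sph n → ThermoElastic.Space n)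
    (ψ ψ' : ThermoElastic.Sph n → ℂ) (hψ : Continuous ψ) (hψ' : Continuous ψ')
    (hr : ∀ j, ContinuousOn (r j) (tsupport ψ))
    (hr_eigen : ∀ j, ∀ η ∈ tsupport ψ, Matrix.toEuclideanLin (A.toFun η) (r j η) =
      ThermoElastic.eigenvalue A j η • r j η)
    (hψ'_one : ∀ η ∈ tsupport ψ, ψ' η = 1)
    (hψ_parabolic : ∀ η ∈ tsupport ψ, ThermoElastic.IsParabolic A r η)
    (ε : ℝ) (hε : 0 < ε) (χ : ℝ → ℝ) (hχ : Continuous χ)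
    (hχ_zero : ∀ s ≤ ε, χ s = 0) (hχ_one : ∀ s, 2 * ε ≤ s → χ s = 1) :
    ∃ c : ℝ, 0 < c ∧ ∀ p q : ℝ≥0∞, 1 ≤ p → p ≤ 2 → 2 ≤ q →
      (∀ s : ℝ, (n : ℝ) * (p⁻¹.toReal - q⁻¹.toReal) < s →
        ∃ K : ℝ, 0 < K ∧
          ∀ (V₀ : 𝓢(ThermoElastic.Space n, ThermoElastic.State n))
            (V : ℝ → ThermoElastic.L2 n),
            ThermoElastic.IsSolution A κ γ r ψ' V₀ V → ∀ t : ℝ, 0 ≤ t →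
              eLpNorm (ThermoElastic.multiplier
                  (fun ξ => (χ ‖ξ‖ : ℂ) * ThermoElastic.homExt ψ ξ) (V t)) q volume ≤
                ENNReal.ofReal (K * Real.exp (-c * t)) * ThermoElastic.sobolevNorm p s V₀) ∧
      (∃ K : ℝ, 0 < K ∧
        ∀ (V₀ : 𝓢(ThermoElastic.Space n, ThermoElastic.State n))
          (V : ℝ → ThermoElastic.L2 n),
          ThermoElastic.IsSolution A κ γ r ψ' V₀ V → ∀ t : ℝ, 0 ≤ t →
            eLpNorm (ThermoElastic.multiplier
                (fun ξ => (1 - (χ ‖ξ‖ : ℂ)) * ThermoElastic.homExt ψ ξ) (V t)) q volume ≤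
              ENNReal.ofReal
                  (K * (1 + t) ^ (-((n : ℝ) / 2) * (p⁻¹.toReal - q⁻¹.toReal))) *
                eLpNorm V₀ p volume) := by
  obtain ⟨c, hc, hdec⟩ := ThermoElastic.exists_hasSolutionDecay hκ hγ hr hr_eigen hψ_parabolic hψ'
    hψ'_one
  have hhigh : Continuous fun s => (χ s : ℂ) := Complex.continuous_ofReal.comp hχ
  have hhigh_zero : ∀ s ≤ ε, (χ s : ℂ) = 0 := fun s hs => by simp [hχ_zero s hs]
  have hhigh_one : ∀ s, 2 * ε ≤ s → (χ s : ℂ) = 1 := fun s hs => by simp [hχ_one s hs]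
  have hhigh_bdd := exists_norm_le_of_eventually_const hhigh hhigh_zero hhigh_one
  have hlow : Continuous fun s => 1 - (χ s : ℂ) := continuous_const.sub hhigh
  have hlow_zero : ∀ s, 2 * ε ≤ s → 1 - (χ s : ℂ) = 0 := fun s hs => by simp [hχ_one s hs]
  have hlow_one : ∀ s ≤ ε, 1 - (χ s : ℂ) = 1 := fun s hs => by simp [hχ_zero s hs]
  have hlow_bdd := exists_norm_le_of_eventually_const hlow hlow_one hlow_zero
  refine ⟨c * min 1 (ε ^ 2), by positivity, fun p q hp hp₂ hq => ?_⟩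
  rw [← ENNReal.toReal_sub_of_le (ENNReal.inv_le_inv.2 (hp₂.trans hq))
    (ENNReal.inv_ne_top.2 (zero_lt_one.trans_le hp).ne')]
  exact ⟨fun s hs => hdec.exists_high_frequency_le (φ := fun s => (χ s : ℂ)) hc.le hψ hhigh
      hhigh_bdd hε.le hhigh_zero hp hp₂ hq hs,
    hdec.exists_low_frequency_le (φ := fun s => 1 - (χ s : ℂ)) hc hψ hlow
      hlow_bdd (by positivity) hlow_zero hp hp₂ hq⟩

theorem mainTheorem6 {n : ℕ} [Fact (3 ≤ n)] (A : ThermoElastic.ElasticSymbol n)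
    (κ γ : ℝ) (hκ : 0 < κ) (hγ : 0 < γ ^ 2)
    (U : Set (ThermoElastic.Sph n)) (hU : IsOpen U)
    (hU_nondeg : ∀ η ∈ U, ThermoElastic.IsNondegenerate A η)
    (r : Fin n → ThermoElastic.Sph n → ThermoElastic.Space n)
    (hr : ThermoElastic.IsEigenframe A U r)
    (ψ ψ' : ThermoElastic.Sph n → ℂ)
    (hψ : ContMDiff (𝓡 (n - 1)) 𝓘(ℝ, ℂ) ∞ ψ) (hψ' : ContMDiff (𝓡 (n - 1)) 𝓘(ℝ, ℂ) ∞ ψ')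
    (hψU : tsupport ψ ⊆ U) (hψ'U : tsupport ψ' ⊆ U)
    (hψ'_one : ∀ η ∈ tsupport ψ, ψ' η = 1)
    (hψ_parabolic : ∀ η ∈ tsupport ψ, ThermoElastic.IsParabolic A r η)
    (ε : ℝ) (hε : 0 < ε) (χ : ℝ → ℝ) (hχ : ContDiff ℝ ∞ χ)
    (hχ_zero : ∀ s ≤ ε, χ s = 0) (hχ_one : ∀ s, 2 * ε ≤ s → χ s = 1) :
    ∃ c : ℝ, 0 < c ∧ ∀ p q : ℝ≥0∞, 1 ≤ p → p ≤ 2 → 2 ≤ q →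
      (∀ s : ℝ, (n : ℝ) * (p⁻¹.toReal - q⁻¹.toReal) < s →
        ∃ K : ℝ, 0 < K ∧
          ∀ (V₀ : 𝓢(ThermoElastic.Space n, ThermoElastic.State n))
            (V : ℝ → ThermoElastic.L2 n),
            ThermoElastic.IsSolution A κ γ r ψ' V₀ V → ∀ t : ℝ, 0 ≤ t →
              eLpNorm (ThermoElastic.multiplier
                  (fun ξ => (χ ‖ξ‖ : ℂ) * ThermoElastic.homExt ψ ξ) (V t)) q volume ≤
                ENNReal.ofReal (K * Real.exp (-c * t)) * ThermoElastic.sobolevNorm p s V₀) ∧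
      (∃ K : ℝ, 0 < K ∧
        ∀ (V₀ : 𝓢(ThermoElastic.Space n, ThermoElastic.State n))
          (V : ℝ → ThermoElastic.L2 n),
          ThermoElastic.IsSolution A κ γ r ψ' V₀ V → ∀ t : ℝ, 0 ≤ t →
            eLpNorm (ThermoElastic.multiplier
                (fun ξ => (1 - (χ ‖ξ‖ : ℂ)) * ThermoElastic.homExt ψ ξ) (V t)) q volume ≤
              ENNReal.ofReal
                  (K * (1 + t) ^ (-((n : ℝ) / 2) * (p⁻¹.toReal - q⁻¹.toReal))) *
                eLpNorm V₀ p volume) := by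
  exact mainTheorem6_general A κ γ hκ (pow_ne_zero_iff two_ne_zero |>.1 hγ.ne') r ψ ψ'
    hψ.continuous hψ'.continuous (fun j => (hr.smooth j).continuousOn.mono hψU)
    (fun j η hη => hr.eigen j η (hψU hη)) hψ'_one hψ_parabolic ε hε χ hχ.continuous hχ_zero hχ_one
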